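/- Let $k$ be a field and let $H$ be a finite quantum groupoid over $k$, i.e. a finite-dimensional weak Hopf algebra: a finite-dimensional $k$-vector space that is a unital associative algebra and a coassociative counital coalgebra $(\Delta,\varepsilon)$, $\Delta(h)=h_{(1)}\otimes h_{(2)}$, such that for all $h,g,f\in H$: $\Delta(hg)=\Delta(h)\Delta(g)$; $\varepsilon(hgf)=\varepsilon(hg_{(1)})\varepsilon(g_{(2)}f)=\varepsilon(hg_{(2)})\varepsilon(g_{(1)}f)$; $(\Delta\otimes\mathrm{id})\Delta(1)=(\Delta(1)\otimes1)(1\otimes\Delta(1))=(1\otimes\Delta(1))(\Delta(1)\otimes1)$; and there is a linear map $S:H\to H$ (the antipode) with $h_{(1)}S(h_{(2)})=\varepsilon_t(h)$, $S(h_{(1)})h_{(2)}=\varepsilon_s(h)$, $S(h_{(1)})h_{(2)}S(h_{(3)})=S(h)$, where $\varepsilon_t(h)=(\varepsilon\otimes\mathrm{id})(\Delta(1)(h\otimes1))$ and $\varepsilon_s(h)=(\mathrm{id}\otimes\varepsilon)((1\otimes h)\Delta(1))$. Put $H_t=\{z\in H:\varepsilon_t(z)=z\}$. The dual space $H^*$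 is a finite quantum groupoid with the transposed structure: $\langle\varphi\psi,h\rangle=\langle\varphi\otimes\psi,\Delta(h)\rangle$, $\langle\Delta(\varphi),h\otimes g\rangle=\langle\varphi,hg\rangle$, $\langle S(\varphi),h\rangle=\langle\varphi,S(h)\rangle$, unit $\varepsilon$, counit $\varphi\mapsto\langle\varphi,1\rangle$. Let $A$ be a left $H$-module algebra: a unital associative $k$-algebra (of arbitrary dimension) that is a left $H$-module, $k$-linearly, with $h\cdot(xy)=(h_{(1)}\cdot x)(h_{(2)}\cdot y)$ and $h\cdot1=\varepsilon_t(h)\cdot1$. The smash product $A\#H$ is the relative tensor product $A\otimes_{H_t}H$, where $x\cdot z=x(z\cdot1)$ for $x\in A$, $z\in H_t$ and $H_t$ acts on $H$ by left multiplication; $x\#h$ denotes the class of $x\otimes h$. It is an algebra with unit $1\#1$ and product $(x\#h)(y\#g)=x(h_{(1)}\cdot y)\#h_{(2)}g$. It is a left $H^*$-module algebra via $\varphi\cdot(x\#h)=x\#(\varphi\rightharpoonup h)$, where $\varphi\rightharpoonup h=h_{(1)}\langle\varphi,h_{(2)}\rangle$, so that $(A\#H)\#H^*$ is defined. It is a right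 $A$-module via $u\cdot w=u(w\#1)$; let $\mathrm{End}(A\#H)_A$ be the algebra, under composition, of right $A$-module endomorphisms of $A\#H$. Theorem. The antipode $S$ is bijective, and there is an isomorphism of $k$-algebras $$\alpha:(A\#H)\#H^*\longrightarrow\mathrm{End}(A\#H)_A$$ such that $$\alpha((x\#h)\#\varphi)(y\#g)=(x\#h)(y\#(\varphi\rightharpoonup g))\qquad(x,y\in A,\ h,g\in H,\ \varphi\in H^*),$$ and whose inverse $\beta$ is given, for every basis $(f_i)$ of $H$ with dual basis $(\psi_i)$ of $H^*$, by $$\beta(T)=\sum_i T(1\#(f_i)_{(2)})\,(1\#S^{-1}((f_i)_{(1)}))\#\psi_i\qquad(T\in\mathrm{End}(A\#H)_A).$$ -/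

import Mathlib

open scoped TensorProduct

namespace QuantumGroupoid

open Coalgebra TensorProduct LinearMap

universe u v w

noncomputable section

section Counital

variable (k : Type u) (H : Type v) [Field k] [Ring H] [Algebra k H] [Coalgebra k H]

/-- The target counital map `ε_t(h) = (ε ⊗ id)(Δ(1)(h ⊗ 1))`. -/
def targetCounit : H →ₗ[k] H :=
  (TensorProduct.lid k H).toLinearMap ∘ₗ (counit (R := k) (A := H)).rTensor H ∘ₗ
    LinearMap.mulLeft k (comul (R := k) (1 : H)) ∘ₗ (TensorProduct.mk k H H).flip 1

/-- The source counital map `ε_s(h) = (id ⊗ ε)((1 ⊗ h)Δ(1))`. -/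
def sourceCounit : H →ₗ[k] H :=
  (TensorProduct.rid k H).toLinearMap ∘ₗ (counit (R := k) (A := H)).lTensor H ∘ₗ
    LinearMap.mulRight k (comul (R := k) (1 : H)) ∘ₗ TensorProduct.mk k H H 1

end Counital

/-- The structure of a weak Hopf algebra on a `k`-algebra and `k`-coalgebra `H`.
A finite quantum groupoid is a weak Hopf algebra that is finite-dimensional over `k`;
finite-dimensionality is a separate assumption `[FiniteDimensional k H]`. -/
class WeakHopfAlgebra (k : Type u) (H : Type v) [Field k] [Ring H] [Algebra k H]
    [Coalgebra k H] where
  /-- `Δ(hg) = Δ(h)Δ(g)`. -/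
  comul_mul (h g : H) : comul (R := k) (h * g) = comul (R := k) h * comul (R := k) g
  /-- `ε(hgf) = ε(hg₁)ε(g₂f)`. -/
  counit_mul_mul (h g f : H) : counit (R := k) (h * g * f) =
    LinearMap.mul' k k (TensorProduct.map (counit (R := k) ∘ₗ LinearMap.mulLeft k h)
      (counit (R := k) ∘ₗ LinearMap.mulRight k f) (comul (R := k) g))
  /-- `ε(hgf) = ε(hg₂)ε(g₁f)`. -/
  counit_mul_mul' (h g f : H) : counit (R := k) (h * g * f) =
    LinearMap.mul' k k (TensorProduct.map (counit (R := k) ∘ₗ LinearMap.mulRight k f)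
      (counit (R := k) ∘ₗ LinearMap.mulLeft k h) (comul (R := k) g))
  /-- `(Δ ⊗ id)Δ(1) = (Δ(1) ⊗ 1)(1 ⊗ Δ(1))`. -/
  comul_comul_one : TensorProduct.assoc k H H H
      ((comul (R := k) (A := H)).rTensor H (comul (R := k) (1 : H))) =
    TensorProduct.assoc k H H H (comul (R := k) (1 : H) ⊗ₜ[k] (1 : H)) *
      ((1 : H) ⊗ₜ[k] comul (R := k) (1 : H))
  /-- `(Δ ⊗ id)Δ(1) = (1 ⊗ Δ(1))(Δ(1) ⊗ 1)`. -/
  comul_comul_one' : TensorProduct.assoc k H H H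
      ((comul (R := k) (A := H)).rTensor H (comul (R := k) (1 : H))) =
    ((1 : H) ⊗ₜ[k] comul (R := k) (1 : H)) *
      TensorProduct.assoc k H H H (comul (R := k) (1 : H) ⊗ₜ[k] (1 : H))
  /-- The antipode `S`. -/
  antipode : H →ₗ[k] H
  /-- `h₁S(h₂) = ε_t(h)`. -/
  mul_antipode (h : H) :
    LinearMap.mul' k H (antipode.lTensor H (comul (R := k) h)) = targetCounit k H h
  /-- `S(h₁)h₂ = ε_s(h)`. -/
  antipode_mul (h : H) :
    LinearMap.mul' k H (antipode.rTensor H (comul (R := k) h)) = sourceCounit k H h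
  /-- `S(h₁)h₂S(h₃) = S(h)`. -/
  antipode_mul_antipode (h : H) :
    LinearMap.mul' k H (TensorProduct.map antipode
      (LinearMap.mul' k H ∘ₗ antipode.lTensor H ∘ₗ comul (R := k)) (comul (R := k) h)) =
    antipode h

/-- A left `H`-module algebra `A`: a unital associative `k`-algebra with a (unital, `k`-linear)
left `H`-module structure such that `h·(xy) = (h₁·x)(h₂·y)` and `h·1 = ε_t(h)·1`. -/
class ModuleAlgebra (k : Type u) (H : Type v) (A : Type w) [Field k] [Ring H] [Algebra k H]
    [Coalgebra k H] [Ring A] [Algebra k A] [Module H A] [IsScalarTower k H A] : Prop where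
  smul_mul (h : H) (x y : A) : h • (x * y) =
    LinearMap.mul' k A (TensorProduct.map ((LinearMap.toSpanSingleton H A x).restrictScalars k)
      ((LinearMap.toSpanSingleton H A y).restrictScalars k) (comul (R := k) h))
  smul_one (h : H) : h • (1 : A) = targetCounit k H h • (1 : A)

section Basics

variable {k : Type u} {H : Type v} [Field k] [Ring H] [Algebra k H] [Coalgebra k H]

theorem targetCounit_apply {ι : Type*} (r : Coalgebra.Repr k (1 : H) ι) (h : H) :
    targetCounit k H h = ∑ i ∈ r.index, counit (R := k) (r.left i * h) • r.right i := by
  simp [targetCounit, ← r.eq, Finset.sum_mul]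

theorem sourceCounit_apply {ι : Type*} (r : Coalgebra.Repr k (1 : H) ι) (h : H) :
    sourceCounit k H h = ∑ i ∈ r.index, counit (R := k) (h * r.right i) • r.left i := by
  simp [sourceCounit, ← r.eq, Finset.mul_sum]

variable [WeakHopfAlgebra k H]

theorem sum_targetCounit_mul {ι : Type*} {h : H} (r : Coalgebra.Repr k h ι) :
    ∑ i ∈ r.index, targetCounit k H (r.left i) * r.right i = h := by
  have key : ∀ X : H ⊗[k] H, LinearMap.mul' k H ((targetCounit k H).rTensor H X) =
      TensorProduct.lid k H ((counit (R := k) (A := H)).rTensor H (comul (R := k) (1 : H) * X)) := by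
    intro X
    induction X with
    | zero => simp
    | add X Y hX hY => simp [mul_add, hX, hY]
    | tmul x y =>
      rw [← (ℛ k (1 : H)).eq]
      simp [targetCounit_apply (ℛ k (1 : H)), Finset.sum_mul]
  have := key (comul (R := k) h)
  rw [← WeakHopfAlgebra.comul_mul, one_mul] at this
  rw [Coalgebra.rTensor_counit_comul, ← r.eq] at this
  simpa using this

/-- `1₁ ⊗ 1₂ ⊗ 1₃ = 1₁ ⊗ 1₂1₁' ⊗ 1₂'`. -/
theorem lTensor_comul_one {ι : Type*} (r : Coalgebra.Repr k (1 : H) ι) :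
    ∑ i ∈ r.index, r.left i ⊗ₜ[k] comul (R := k) (r.right i) =
      ∑ i ∈ r.index, ∑ j ∈ r.index,
        r.left i ⊗ₜ[k] ((r.right i * r.left j) ⊗ₜ[k] r.right j) := by
  have := WeakHopfAlgebra.comul_comul_one (k := k) (H := H)
  rw [Coalgebra.coassoc_apply, ← r.eq] at this
  rw [Finset.sum_comm]
  simpa [TensorProduct.sum_tmul, TensorProduct.tmul_sum, Finset.sum_mul, Finset.mul_sum]
    using this

/-- `1₁ ⊗ 1₂ ⊗ 1₃ = 1₁ ⊗ 1₁'1₂ ⊗ 1₂'`. -/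
theorem lTensor_comul_one' {ι : Type*} (r : Coalgebra.Repr k (1 : H) ι) :
    ∑ i ∈ r.index, r.left i ⊗ₜ[k] comul (R := k) (r.right i) =
      ∑ i ∈ r.index, ∑ j ∈ r.index,
        r.left i ⊗ₜ[k] ((r.left j * r.right i) ⊗ₜ[k] r.right j) := by
  have := WeakHopfAlgebra.comul_comul_one' (k := k) (H := H)
  rw [Coalgebra.coassoc_apply, ← r.eq] at this
  simpa [TensorProduct.sum_tmul, TensorProduct.tmul_sum, Finset.sum_mul, Finset.mul_sum]
    using this

/-- `1₁ ⊗ ε_t(1₂) = 1₁ ⊗ 1₂`. -/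
theorem sum_tmul_targetCounit {ι : Type*} (r : Coalgebra.Repr k (1 : H) ι) :
    ∑ i ∈ r.index, r.left i ⊗ₜ[k] targetCounit k H (r.right i) =
      ∑ i ∈ r.index, r.left i ⊗ₜ[k] r.right i := by
  have := congrArg (((TensorProduct.lid k H).toLinearMap ∘ₗ
    (counit (R := k) (A := H)).rTensor H).lTensor H) (lTensor_comul_one' r)
  simp only [map_sum, LinearMap.lTensor_tmul, LinearMap.comp_apply,
    Coalgebra.rTensor_counit_comul, LinearEquiv.coe_coe, TensorProduct.lid_tmul, one_smul,
    LinearMap.rTensor_tmul] at this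
  rw [this]
  refine Finset.sum_congr rfl fun i _ => ?_
  rw [targetCounit_apply r, TensorProduct.tmul_sum]

theorem targetCounit_targetCounit (h : H) :
    targetCounit k H (targetCounit k H h) = targetCounit k H h := by
  have := congrArg ((TensorProduct.lid k H).toLinearMap ∘ₗ
    (counit (R := k) (A := H) ∘ₗ LinearMap.mulRight k h).rTensor H)
    (sum_tmul_targetCounit (ℛ k (1 : H)))
  rw [targetCounit_apply (ℛ k (1 : H)) h, map_sum]
  simpa using this

/-- `Δ(z) = z1₁ ⊗ 1₂` for `z ∈ H_t`. -/
theorem comul_target {z : H} (hz : targetCounit k H z = z) :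
    comul (R := k) z = (z ⊗ₜ[k] 1) * comul (R := k) (1 : H) := by
  have := congrArg ((TensorProduct.lid k (H ⊗[k] H)).toLinearMap ∘ₗ
    (counit (R := k) (A := H) ∘ₗ LinearMap.mulRight k z).rTensor (H ⊗[k] H))
    (lTensor_comul_one (ℛ k (1 : H)))
  conv_lhs => rw [← hz]
  conv_rhs => rw [← hz]
  conv_rhs => rw [← (ℛ k (1 : H)).eq]
  rw [targetCounit_apply (ℛ k (1 : H)) z, map_sum]
  simp only [map_sum, LinearMap.comp_apply, LinearMap.rTensor_tmul, LinearMap.mulRight_apply,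
    LinearEquiv.coe_coe, TensorProduct.lid_tmul] at this
  simp only [map_smul, this, TensorProduct.sum_tmul, Finset.mul_sum, Finset.sum_mul,
    Algebra.TensorProduct.tmul_mul_tmul, one_mul]
  rw [Finset.sum_comm]
  simp [TensorProduct.smul_tmul']

/-- `Δ(z) = 1₁z ⊗ 1₂` for `z ∈ H_t`. -/
theorem comul_target' {z : H} (hz : targetCounit k H z = z) :
    comul (R := k) z = comul (R := k) (1 : H) * (z ⊗ₜ[k] 1) := by
  have := congrArg ((TensorProduct.lid k (H ⊗[k] H)).toLinearMap ∘ₗ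
    (counit (R := k) (A := H) ∘ₗ LinearMap.mulRight k z).rTensor (H ⊗[k] H))
    (lTensor_comul_one' (ℛ k (1 : H)))
  conv_lhs => rw [← hz]
  conv_rhs => rw [← hz]
  conv_rhs => rw [← (ℛ k (1 : H)).eq]
  rw [targetCounit_apply (ℛ k (1 : H)) z, map_sum]
  simpa [TensorProduct.tmul_sum, TensorProduct.sum_tmul, Finset.mul_sum, Finset.sum_mul,
    TensorProduct.smul_tmul'] using this

/-- `Δ(zh) = zh₁ ⊗ h₂` for `z ∈ H_t`. -/
theorem comul_target_mul {z : H} (hz : targetCounit k H z = z) (h : H) :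
    comul (R := k) (z * h) = (z ⊗ₜ[k] 1) * comul (R := k) h := by
  rw [WeakHopfAlgebra.comul_mul, comul_target hz, mul_assoc, ← WeakHopfAlgebra.comul_mul, one_mul]

/-- `Δ(hz) = h₁z ⊗ h₂` for `z ∈ H_t`. -/
theorem comul_mul_target {z : H} (hz : targetCounit k H z = z) (h : H) :
    comul (R := k) (h * z) = comul (R := k) h * (z ⊗ₜ[k] 1) := by
  rw [WeakHopfAlgebra.comul_mul, comul_target' hz, ← mul_assoc, ← WeakHopfAlgebra.comul_mul,
    mul_one]

/-- `ε_t(h₁z)h₂ = hz` for `z ∈ H_t`. -/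
theorem sum_targetCounit_mul_target {ι : Type*} {h : H} (r : Coalgebra.Repr k h ι) {z : H}
    (hz : targetCounit k H z = z) :
    ∑ i ∈ r.index, targetCounit k H (r.left i * z) * r.right i = h * z := by
  refine sum_targetCounit_mul (h := h * z)
    (⟨r.index, fun i => r.left i * z, r.right, ?_⟩ : Coalgebra.Repr k (h * z) ι)
  rw [comul_mul_target hz, ← r.eq, Finset.sum_mul]
  simp

end Basics

section Smash

variable (k : Type u) (A : Type w) (H : Type v) [Field k] [Ring H] [Algebra k H] [Coalgebra k H]
  [Ring A] [Algebra k A] [Module H A]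

/-- The subspace of `A ⊗ H` spanned by the elements `x(z·1) ⊗ h - x ⊗ zh` with `z ∈ H_t`, i.e.
`ε_t(z) = z`. -/
def smashRel : Submodule k (A ⊗[k] H) :=
  Submodule.span k {t | ∃ (x : A) (z h : H), targetCounit k H z = z ∧
    t = (x * z • (1 : A)) ⊗ₜ[k] h - x ⊗ₜ[k] (z * h)}

/-- The underlying space of the smash product `A # H`: the relative tensor product
`A ⊗_{H_t} H`, where `H_t = {z | ε_t(z) = z}` acts on `A` from the right by `x·z = x(z·1)` and on
`H` by left multiplication. -/
def SmashProduct : Type (max w v) := (A ⊗[k] H) ⧸ smashRel k A H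

namespace SmashProduct

instance : AddCommGroup (SmashProduct k A H) :=
  inferInstanceAs (AddCommGroup ((A ⊗[k] H) ⧸ smashRel k A H))

instance : Module k (SmashProduct k A H) :=
  inferInstanceAs (Module k ((A ⊗[k] H) ⧸ smashRel k A H))

/-- The quotient map `A ⊗ H → A ⊗_{H_t} H`. -/
def proj : (A ⊗[k] H) →ₗ[k] SmashProduct k A H := (smashRel k A H).mkQ

variable {A H}

/-- The class `x # h` of `x ⊗ h` in `A # H`. -/
def mk (x : A) (h : H) : SmashProduct k A H := proj k A H (x ⊗ₜ[k] h)

variable {k}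

theorem proj_surjective : Function.Surjective (proj k A H) := Submodule.mkQ_surjective _

theorem proj_tmul (x : A) (h : H) : proj k A H (x ⊗ₜ[k] h) = mk k x h := rfl

theorem proj_eq_zero {t : A ⊗[k] H} (ht : t ∈ smashRel k A H) : proj k A H t = 0 :=
  (Submodule.Quotient.mk_eq_zero _).2 ht

/-- `(x·z) # h = x # zh` for `z ∈ H_t`. -/
theorem mk_balanced (x : A) {z : H} (hz : targetCounit k H z = z) (h : H) :
    mk k (x * z • (1 : A)) h = mk k x (z * h) := by
  rw [← sub_eq_zero]
  change proj k A H _ - proj k A H _ = 0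
  rw [← map_sub]
  exact proj_eq_zero (Submodule.subset_span ⟨x, z, h, hz, rfl⟩)

/-- Linear maps out of `A ⊗_{H_t} H`. -/
def liftLin {M : Type*} [AddCommGroup M] [Module k M] (f : (A ⊗[k] H) →ₗ[k] M)
    (hf : ∀ (x : A) (z h : H), targetCounit k H z = z →
      f ((x * z • (1 : A)) ⊗ₜ[k] h) = f (x ⊗ₜ[k] (z * h))) : SmashProduct k A H →ₗ[k] M :=
  (smashRel k A H).liftQ f (by
    rw [smashRel, Submodule.span_le]
    rintro _ ⟨x, z, h, hz, rfl⟩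
    simp [hf x z h hz])

theorem liftLin_proj {M : Type*} [AddCommGroup M] [Module k M] (f : (A ⊗[k] H) →ₗ[k] M)
    (hf : ∀ (x : A) (z h : H), targetCounit k H z = z →
      f ((x * z • (1 : A)) ⊗ₜ[k] h) = f (x ⊗ₜ[k] (z * h))) (t : A ⊗[k] H) :
    liftLin f hf (proj k A H t) = f t := rfl

@[elab_as_elim]
theorem induction_on {P : SmashProduct k A H → Prop} (u : SmashProduct k A H)
    (zero : P 0) (mk : ∀ x h, P (mk k x h)) (add : ∀ u v, P u → P v → P (u + v)) : P u := by
  obtain ⟨t, rfl⟩ := proj_surjective u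
  induction t with
  | zero => simpa using zero
  | tmul x h => exact mk x h
  | add s t hs ht => rw [map_add]; exact add _ _ hs ht

variable [IsScalarTower k H A]

/-- The action of `H ⊗ H` on `A ⊗ H` by `(a ⊗ b)(y ⊗ g) = (a·y) ⊗ bg`. -/
def act : (H ⊗[k] H) →ₗ[k] (A ⊗[k] H) →ₗ[k] (A ⊗[k] H) :=
  TensorProduct.homTensorHomMap (RingHom.id k) A H A H ∘ₗ
    TensorProduct.map (Algebra.lsmul k k A).toLinearMap (LinearMap.mul k H)

@[simp] theorem act_tmul (a b : H) (y : A) (g : H) :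
    act (k := k) (a ⊗ₜ b) (y ⊗ₜ g) = (a • y) ⊗ₜ (b * g) := rfl

theorem act_mul (X Y : H ⊗[k] H) (t : A ⊗[k] H) : act (X * Y) t = act X (act Y t) := by
  induction X with
  | zero => simp
  | add X X' h h' => simp [add_mul, h, h']
  | tmul a b =>
    induction Y with
    | zero => simp
    | add X X' h h' => simp [mul_add, h, h']
    | tmul c d =>
      induction t with
      | zero => simp
      | add X X' h h' => simp only [map_add, h, h']
      | tmul y g => simp [mul_smul, mul_assoc]

/-- The bilinear map `(x ⊗ h, y ⊗ g) ↦ x(h₁·y) ⊗ h₂g` on `A ⊗ H`. -/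
def preMul : (A ⊗[k] H) →ₗ[k] (A ⊗[k] H) →ₗ[k] (A ⊗[k] H) :=
  TensorProduct.lift (LinearMap.mk₂ k
    (fun x h => (LinearMap.mul k A x).rTensor H ∘ₗ act (comul (R := k) h))
    (fun x y h => by ext; simp [LinearMap.rTensor_add])
    (fun c x h => by ext; simp [LinearMap.rTensor_smul])
    (fun x h g => by ext; simp)
    (fun c x h => by ext; simp))

theorem preMul_tmul (x : A) (h : H) (t : A ⊗[k] H) :
    preMul (x ⊗ₜ[k] h) t = (LinearMap.mul k A x).rTensor H (act (comul (R := k) h) t) := rfl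

theorem preMul_tmul_tmul {ι : Type*} (x y : A) {h : H} (g : H) (r : Coalgebra.Repr k h ι) :
    preMul (x ⊗ₜ[k] h) (y ⊗ₜ[k] g) =
      ∑ i ∈ r.index, (x * r.left i • y) ⊗ₜ[k] (r.right i * g) := by
  rw [preMul_tmul, ← r.eq]
  simp

variable [ModuleAlgebra k H A]

theorem smul_mul_sum {ι : Type*} {h : H} (r : Coalgebra.Repr k h ι) (x y : A) :
    h • (x * y) = ∑ i ∈ r.index, (r.left i • x) * (r.right i • y) := by
  rw [ModuleAlgebra.smul_mul (k := k) h x y, ← r.eq]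
  simp

theorem mk_mul_smul_one (x : A) (h g : H) (_ : WeakHopfAlgebra k H) :
    mk k (x * h • (1 : A)) g = mk k x (targetCounit k H h * g) := by
  rw [ModuleAlgebra.smul_one (k := k) h, mk_balanced _ (targetCounit_targetCounit h)]

variable [WeakHopfAlgebra k H]

theorem target_smul {z : H} (hz : targetCounit k H z = z) (y : A) :
    z • y = (z • (1 : A)) * y := by
  have e : comul (R := k) z = ∑ i ∈ (ℛ k (1 : H)).index,
      ((ℛ k (1 : H)).left i * z) ⊗ₜ[k] (ℛ k (1 : H)).right i := by
    rw [comul_target' hz]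
    conv_lhs => rw [← (ℛ k (1 : H)).eq]
    simp [Finset.sum_mul]
  have h1 := smul_mul_sum (⟨_, _, _, e.symm⟩ : Coalgebra.Repr k z _) (1 : A) y
  have h2 := smul_mul_sum (ℛ k (1 : H)) (z • (1 : A)) y
  simp only [one_mul, one_smul, mul_smul] at h1 h2
  rw [h1, h2]

theorem preMul_balanced_left (x : A) {z : H} (hz : targetCounit k H z = z) (h : H)
    (t : A ⊗[k] H) : preMul ((x * z • (1 : A)) ⊗ₜ[k] h) t = preMul (x ⊗ₜ[k] (z * h)) t := by
  rw [preMul_tmul, preMul_tmul, comul_target_mul hz, act_mul]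
  generalize act (comul (R := k) h) t = s
  induction s with
  | zero => simp
  | add s t hs ht => simp only [map_add, hs, ht]
  | tmul y g => simp [mul_assoc, target_smul hz y]

theorem preMul_balanced_right (t : A ⊗[k] H) (y : A) {z : H} (hz : targetCounit k H z = z)
    (g : H) : proj k A H (preMul t ((y * z • (1 : A)) ⊗ₜ[k] g)) =
      proj k A H (preMul t (y ⊗ₜ[k] (z * g))) := by
  induction t with
  | zero => simp
  | add s t hs ht => simp only [map_add, LinearMap.add_apply, hs, ht]
  | tmul x h =>
    have hc := congrArg (proj k A H ∘ₗ TensorProduct.map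
        (LinearMap.mul k A x ∘ₗ (LinearMap.toSpanSingleton H A y).restrictScalars k)
        (LinearMap.mul' k H ∘ₗ TensorProduct.map (targetCounit k H ∘ₗ LinearMap.mulRight k z)
          (LinearMap.mulRight k g)))
      (Coalgebra.sum_tmul_tmul_eq (ℛ k h) (fun i => ℛ k ((ℛ k h).left i))
        (fun i => ℛ k ((ℛ k h).right i)))
    simp only [map_sum, LinearMap.comp_apply, TensorProduct.map_tmul, LinearMap.mul'_apply,
      LinearMap.mulRight_apply, LinearMap.restrictScalars_apply, LinearMap.mul_apply',
      LinearMap.toSpanSingleton_apply, proj_tmul] at hc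
    rw [preMul_tmul_tmul _ _ _ (ℛ k h), preMul_tmul_tmul _ _ _ (ℛ k h)]
    simp only [map_sum, proj_tmul]
    calc _ = _ := ?_
      _ = _ := hc
      _ = _ := ?_
    · refine Finset.sum_congr rfl fun i _ => ?_
      rw [smul_mul_sum (ℛ k ((ℛ k h).left i)), Finset.mul_sum]
      simp only [← proj_tmul, TensorProduct.sum_tmul, map_sum]
      refine Finset.sum_congr rfl fun j _ => ?_
      rw [proj_tmul, proj_tmul, ← mul_smul, ← mul_assoc, mk_mul_smul_one _ _ _ inferInstance]
    · refine Finset.sum_congr rfl fun i _ => ?_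
      rw [← mul_assoc ((ℛ k h).right i), ← sum_targetCounit_mul_target (ℛ k ((ℛ k h).right i)) hz]
      simp only [← proj_tmul, TensorProduct.tmul_sum, map_sum, Finset.sum_mul, mul_assoc]

/-- The multiplication of `A # H` as a bilinear map. -/
def mulLin : SmashProduct k A H →ₗ[k] SmashProduct k A H →ₗ[k] SmashProduct k A H :=
  liftLin
    { toFun := fun t => liftLin (proj k A H ∘ₗ preMul t)
        (fun y _ g hz => preMul_balanced_right t y hz g)
      map_add' := fun s t => by
        ext u
        obtain ⟨u, rfl⟩ := proj_surjective u
        simp [liftLin_proj]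
      map_smul' := fun c t => by
        ext u
        obtain ⟨u, rfl⟩ := proj_surjective u
        simp [liftLin_proj] }
    (fun x z h hz => by
      ext u
      obtain ⟨u, rfl⟩ := proj_surjective u
      simp [liftLin_proj, preMul_balanced_left x hz h])

instance : Mul (SmashProduct k A H) := ⟨fun u v => mulLin u v⟩

instance : One (SmashProduct k A H) := ⟨mk k 1 1⟩

theorem one_def : (1 : SmashProduct k A H) = mk k 1 1 := rfl

theorem mul_def (u v : SmashProduct k A H) : u * v = mulLin u v := rfl

theorem proj_mul_proj (s t : A ⊗[k] H) :
    proj k A H s * proj k A H t = proj k A H (preMul s t) := rfl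

/-- `(x # h)(y # g) = x(h₁·y) # h₂g`. -/
theorem mk_mul_mk {ι : Type*} (x y : A) {h : H} (g : H) (r : Coalgebra.Repr k h ι) :
    mk k x h * mk k y g = ∑ i ∈ r.index, mk k (x * r.left i • y) (r.right i * g) := by
  rw [mk, mk, proj_mul_proj, preMul_tmul_tmul _ _ _ r, map_sum]
  rfl

theorem act_comul_mul {ι : Type*} {h : H} (r : Coalgebra.Repr k h ι) (y : A) (t : A ⊗[k] H) :
    act (comul (R := k) h) ((LinearMap.mul k A y).rTensor H t) =
      ∑ i ∈ r.index, (LinearMap.mul k A (r.left i • y)).rTensor H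
        (act (comul (R := k) (r.right i)) t) := by
  induction t with
  | zero => simp
  | add s t hs ht => simp only [map_add, Finset.sum_add_distrib, hs, ht]
  | tmul w f =>
    have hc := congrArg ((LinearMap.mul' k A).rTensor H ∘ₗ
        (TensorProduct.assoc k A A H).symm.toLinearMap ∘ₗ TensorProduct.map
        ((LinearMap.toSpanSingleton H A y).restrictScalars k)
        (TensorProduct.map ((LinearMap.toSpanSingleton H A w).restrictScalars k)
          (LinearMap.mulRight k f)))
      (Coalgebra.sum_tmul_tmul_eq r (fun i => ℛ k (r.left i)) (fun i => ℛ k (r.right i)))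
    simp only [map_sum, LinearMap.comp_apply, TensorProduct.map_tmul, LinearMap.mul'_apply,
      LinearMap.mulRight_apply, LinearMap.restrictScalars_apply, LinearEquiv.coe_coe,
      TensorProduct.assoc_symm_tmul, LinearMap.rTensor_tmul,
      LinearMap.toSpanSingleton_apply] at hc
    calc _ = _ := ?_
      _ = _ := hc
      _ = _ := ?_
    · rw [← r.eq]
      simp only [map_sum, LinearMap.sum_apply, LinearMap.rTensor_tmul, act_tmul,
        LinearMap.mul_apply']
      refine Finset.sum_congr rfl fun i _ => ?_
      rw [smul_mul_sum (ℛ k (r.left i)), TensorProduct.sum_tmul]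
    · refine Finset.sum_congr rfl fun i _ => ?_
      rw [← (ℛ k (r.right i)).eq]
      simp only [map_sum, LinearMap.sum_apply, LinearMap.rTensor_tmul, act_tmul,
        LinearMap.mul_apply']

theorem mul_assoc_aux (s t w : A ⊗[k] H) :
    preMul (preMul s t) w = preMul s (preMul t w) := by
  induction s with
  | zero => simp
  | add s t hs ht => simp only [map_add, LinearMap.add_apply, hs, ht]
  | tmul x h =>
    induction t with
    | zero => simp
    | add s t hs ht => simp only [map_add, LinearMap.add_apply, hs, ht]
    | tmul y g =>
      rw [preMul_tmul_tmul _ _ _ (ℛ k h), preMul_tmul x, preMul_tmul y,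
        act_comul_mul (ℛ k h)]
      simp only [map_sum, LinearMap.sum_apply, preMul_tmul, WeakHopfAlgebra.comul_mul, act_mul]
      refine Finset.sum_congr rfl fun i _ => ?_
      generalize act (comul (R := k) ((ℛ k h).right i)) (act (comul (R := k) g) w) = t
      rw [← LinearMap.rTensor_comp_apply]
      congr 2
      ext
      simp [mul_assoc]

theorem mul_one_aux (u : SmashProduct k A H) : u * 1 = u := by
  induction u using induction_on with
  | zero => simp [mul_def]
  | add u v hu hv => simp only [mul_def, map_add, LinearMap.add_apply] at *; rw [hu, hv]
  | mk x h =>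
    rw [one_def, mk_mul_mk _ _ _ (ℛ k h)]
    simp only [mk_mul_smul_one _ _ _ inferInstance, mul_one]
    conv_rhs => rw [← sum_targetCounit_mul (ℛ k h)]
    simp only [← proj_tmul, TensorProduct.tmul_sum, map_sum]

/-- `(x # 1)(y # g) = xy # g`. -/
theorem mk_one_mul_mk (x y : A) (g : H) : mk k x (1 : H) * mk k y g = mk k (x * y) g := by
  rw [mk_mul_mk _ _ _ (ℛ k (1 : H))]
  have h1 := smul_mul_sum (ℛ k (1 : H)) y (1 : A)
  rw [one_smul, mul_one] at h1
  conv_rhs => rw [h1]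
  have hc := congrArg (proj k A H ∘ₗ TensorProduct.map
    (LinearMap.mul k A x ∘ₗ (LinearMap.toSpanSingleton H A y).restrictScalars k)
    (LinearMap.mulRight k g))
    (sum_tmul_targetCounit (ℛ k (1 : H)))
  simp only [map_sum, LinearMap.comp_apply, TensorProduct.map_tmul,
    LinearMap.mulRight_apply, LinearMap.restrictScalars_apply, LinearMap.mul_apply',
    LinearMap.toSpanSingleton_apply, proj_tmul] at hc
  rw [← hc]
  simp only [← mk_mul_smul_one _ _ _ (inferInstance : WeakHopfAlgebra k H)]
  simp only [← proj_tmul, TensorProduct.sum_tmul, map_sum, Finset.mul_sum, mul_assoc]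

theorem one_mul_aux (u : SmashProduct k A H) : 1 * u = u := by
  induction u using induction_on with
  | zero => simp [mul_def]
  | add u v hu hv => simp only [mul_def, map_add] at *; rw [hu, hv]
  | mk y g => rw [one_def, mk_one_mul_mk, one_mul]

/-- The smash product algebra. -/
instance : Ring (SmashProduct k A H) :=
  { (inferInstance : AddCommGroup (SmashProduct k A H)),
    (inferInstance : Mul (SmashProduct k A H)),
    (inferInstance : One (SmashProduct k A H)) with
    left_distrib := fun u v w => map_add (mulLin u) v w
    right_distrib := fun u v w => by simp [mul_def]
    zero_mul := fun u => by simp [mul_def]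
    mul_zero := fun u => by simp [mul_def]
    mul_assoc := fun u v w => by
      obtain ⟨u, rfl⟩ := proj_surjective u
      obtain ⟨v, rfl⟩ := proj_surjective v
      obtain ⟨w, rfl⟩ := proj_surjective w
      simp only [proj_mul_proj, mul_assoc_aux]
    one_mul := one_mul_aux
    mul_one := mul_one_aux }

instance : Algebra k (SmashProduct k A H) :=
  Algebra.ofModule (fun c u v => by simp [mul_def]) (fun c u v => by simp [mul_def])

/-- The right `A`-module structure of `A # H` by multiplication:
`u·w = u(w # 1)` for `w ∈ A`. -/
instance : Module Aᵐᵒᵖ (SmashProduct k A H) where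
  smul w u := u * mk k w.unop 1
  one_smul u := mul_one u
  mul_smul v w u := by
    change u * mk k (w.unop * v.unop) 1 = u * mk k w.unop 1 * mk k v.unop 1
    rw [mul_assoc, mk_one_mul_mk]
  smul_zero w := zero_mul _
  smul_add w u v := add_mul _ _ _
  add_smul v w u := by
    change u * mk k (v.unop + w.unop) 1 = u * mk k v.unop 1 + u * mk k w.unop 1
    rw [← mul_add]
    simp only [← proj_tmul, TensorProduct.add_tmul, map_add]
  zero_smul u := by
    change u * mk k 0 1 = 0
    simp only [← proj_tmul, TensorProduct.zero_tmul, map_zero, mul_zero]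

theorem op_smul_def (w : A) (u : SmashProduct k A H) :
    MulOpposite.op w • u = u * mk k w 1 := rfl

instance : IsScalarTower k Aᵐᵒᵖ (SmashProduct k A H) where
  smul_assoc c w u := by
    change u * mk k (c • w.unop) 1 = c • (u * mk k w.unop 1)
    rw [← mul_smul_comm]
    simp only [← proj_tmul, ← TensorProduct.smul_tmul', map_smul]

instance : SMulCommClass Aᵐᵒᵖ k (SmashProduct k A H) where
  smul_comm w c u := smul_mul_assoc c u (mk k w.unop 1)

end SmashProduct

end Smash

section Dual

variable (k : Type u) (H : Type v) [Field k] [Ring H] [Algebra k H] [Coalgebra k H]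

/-- The dual space `H^*`. Its algebra structure is the convolution product
`⟨φψ, h⟩ = ⟨φ, h₁⟩⟨ψ, h₂⟩`, with unit `ε`. -/
def DualAlg : Type (max v u) := WithConv (H →ₗ[k] k)

instance : Ring (DualAlg k H) := inferInstanceAs (Ring (WithConv (H →ₗ[k] k)))

instance : Algebra k (DualAlg k H) := inferInstanceAs (Algebra k (WithConv (H →ₗ[k] k)))

variable {k H}

/-- Elements of `H^*` are the linear forms on `H`. -/
def toLin : DualAlg k H ≃ₗ[k] (H →ₗ[k] k) where
  toFun φ := WithConv.ofConv φ
  invFun φ := WithConv.toConv φ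
  map_add' _ _ := rfl
  map_smul' _ _ := rfl
  left_inv _ := rfl
  right_inv _ := rfl

instance : CoeFun (DualAlg k H) (fun _ => H → k) := ⟨fun φ => toLin φ⟩

@[ext] theorem DualAlg.ext {φ ψ : DualAlg k H} (h : ∀ x : H, φ x = ψ x) : φ = ψ :=
  toLin.injective (LinearMap.ext h)

theorem dual_mul_apply {ι : Type*} {h : H} (r : Coalgebra.Repr k h ι) (φ ψ : DualAlg k H) :
    (φ * ψ) h = ∑ i ∈ r.index, φ (r.left i) * ψ (r.right i) :=
  r.convMul_apply (R := k) (A := k) φ ψ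

theorem dual_one_apply (h : H) : (1 : DualAlg k H) h = counit (R := k) h := rfl

variable [FiniteDimensional k H]

/-- The pairing of `H^* ⊗ H^*` with `H ⊗ H`: `⟨φ ⊗ ψ, h ⊗ g⟩ = ⟨φ, h⟩⟨ψ, g⟩`. -/
def ev2 : (DualAlg k H ⊗[k] DualAlg k H) ≃ₗ[k] (H ⊗[k] H →ₗ[k] k) :=
  (TensorProduct.congr toLin
    toLin).trans (TensorProduct.dualDistribEquiv k H H)

@[simp] theorem ev2_tmul (φ ψ : DualAlg k H) (h g : H) :
    ev2 (φ ⊗ₜ[k] ψ) (h ⊗ₜ[k] g) = φ h * ψ g := by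
  simp [ev2, TensorProduct.dualDistribEquiv, TensorProduct.dualDistribEquivOfBasis]

/-- The pairing of `H^* ⊗ H^* ⊗ H^*` with `H ⊗ H ⊗ H`. -/
def ev3 : (DualAlg k H ⊗[k] (DualAlg k H ⊗[k] DualAlg k H)) ≃ₗ[k]
    (H ⊗[k] (H ⊗[k] H) →ₗ[k] k) :=
  (TensorProduct.congr toLin ev2).trans
    (TensorProduct.dualDistribEquiv k H (H ⊗[k] H))

@[simp] theorem ev3_tmul (φ : DualAlg k H) (X : DualAlg k H ⊗[k] DualAlg k H) (h : H)
    (t : H ⊗[k] H) : ev3 (φ ⊗ₜ[k] X) (h ⊗ₜ[k] t) = φ h * ev2 X t := by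
  simp [ev3, TensorProduct.dualDistribEquiv, TensorProduct.dualDistribEquivOfBasis]

theorem ev2_ext {X Y : DualAlg k H ⊗[k] DualAlg k H}
    (h : ∀ a b : H, ev2 X (a ⊗ₜ[k] b) = ev2 Y (a ⊗ₜ[k] b)) : X = Y :=
  ev2.injective (TensorProduct.ext' h)

theorem ev3_ext {X Y : DualAlg k H ⊗[k] (DualAlg k H ⊗[k] DualAlg k H)}
    (h : ∀ a b c : H, ev3 X (a ⊗ₜ[k] (b ⊗ₜ[k] c)) = ev3 Y (a ⊗ₜ[k] (b ⊗ₜ[k] c))) : X = Y :=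
  ev3.injective (TensorProduct.ext_threefold' h)

/-- The comultiplication and counit of `H^*`: `⟨Δ(φ), h ⊗ g⟩ = ⟨φ, hg⟩` and `ε(φ) = ⟨φ, 1⟩`. -/
instance : CoalgebraStruct k (DualAlg k H) where
  comul := ev2.symm.toLinearMap ∘ₗ (LinearMap.lcomp k k (LinearMap.mul' k H)) ∘ₗ
    toLin.toLinearMap
  counit := LinearMap.applyₗ (1 : H) ∘ₗ toLin.toLinearMap

theorem ev2_comul (φ : DualAlg k H) (h g : H) :
    ev2 (comul (R := k) φ) (h ⊗ₜ[k] g) = φ (h * g) := by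
  simp [CoalgebraStruct.comul]

theorem dual_counit (φ : DualAlg k H) : counit (R := k) φ = φ 1 := rfl

theorem ev3_lTensor_comul (X : DualAlg k H ⊗[k] DualAlg k H) (h g f : H) :
    ev3 ((comul (R := k)).lTensor _ X) (h ⊗ₜ[k] (g ⊗ₜ[k] f)) = ev2 X (h ⊗ₜ[k] (g * f)) := by
  induction X with
  | zero => simp
  | add X Y hX hY => simp only [map_add, LinearMap.add_apply, hX, hY]
  | tmul φ ψ => simp [ev2_comul]

theorem ev3_assoc (Y : DualAlg k H ⊗[k] DualAlg k H) (ψ : DualAlg k H) (h g f : H) :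
    ev3 (TensorProduct.assoc k _ _ _ (Y ⊗ₜ[k] ψ)) (h ⊗ₜ[k] (g ⊗ₜ[k] f)) =
      ev2 Y (h ⊗ₜ[k] g) * ψ f := by
  induction Y with
  | zero => simp
  | add X Y hX hY => simp only [map_add, LinearMap.add_apply, TensorProduct.add_tmul, hX, hY, add_mul]
  | tmul φ ψ => simp [mul_assoc]

theorem ev3_assoc_rTensor_comul (X : DualAlg k H ⊗[k] DualAlg k H) (h g f : H) :
    ev3 (TensorProduct.assoc k _ _ _ ((comul (R := k)).rTensor _ X)) (h ⊗ₜ[k] (g ⊗ₜ[k] f)) =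
      ev2 X ((h * g) ⊗ₜ[k] f) := by
  induction X with
  | zero => simp
  | add X Y hX hY => simp only [map_add, LinearMap.add_apply, hX, hY]
  | tmul φ ψ => rw [LinearMap.rTensor_tmul, ev3_assoc, ev2_comul, ev2_tmul]

instance : Coalgebra k (DualAlg k H) where
  coassoc := by
    ext1 φ
    refine ev3_ext fun a b c => ?_
    simp only [LinearMap.comp_apply, LinearEquiv.coe_coe]
    rw [ev3_assoc_rTensor_comul, ev3_lTensor_comul, ev2_comul, ev2_comul, mul_assoc]
  rTensor_counit_comp_comul := by
    ext1 φ
    apply (TensorProduct.lid k (DualAlg k H)).injective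
    have key : ∀ (X : DualAlg k H ⊗[k] DualAlg k H) (h : H),
        (TensorProduct.lid k (DualAlg k H) ((counit (R := k)).rTensor _ X)) h =
          ev2 X (1 ⊗ₜ[k] h) := by
      intro X h
      induction X with
      | zero => simp
      | add X Y hX hY => simp only [map_add, LinearMap.add_apply, hX, hY]
      | tmul φ ψ => simp [dual_counit]
    ext h
    simp [key, ev2_comul]
  lTensor_counit_comp_comul := by
    ext1 φ
    apply (TensorProduct.rid k (DualAlg k H)).injective
    have key : ∀ (X : DualAlg k H ⊗[k] DualAlg k H) (h : H),
        (TensorProduct.rid k (DualAlg k H) ((counit (R := k)).lTensor _ X)) h =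
          ev2 X (h ⊗ₜ[k] 1) := by
      intro X h
      induction X with
      | zero => simp
      | add X Y hX hY => simp only [map_add, LinearMap.add_apply, hX, hY]
      | tmul φ ψ => simp [dual_counit, mul_comm]
    ext h
    simp [key, ev2_comul]

theorem dual_mul_one_apply (φ ψ : DualAlg k H) : (φ * ψ) 1 =
    ∑ i ∈ (ℛ k (1 : H)).index, φ ((ℛ k (1 : H)).left i) * ψ ((ℛ k (1 : H)).right i) :=
  dual_mul_apply _ φ ψ

/-- The target counital map of `H^*` is the transpose of that of `H`. -/
theorem dual_targetCounit (φ : DualAlg k H) (h : H) :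
    targetCounit k (DualAlg k H) φ h = φ (targetCounit k H h) := by
  have key : ∀ (X : DualAlg k H ⊗[k] DualAlg k H) (h : H),
      (TensorProduct.lid k (DualAlg k H) ((counit (R := k)).rTensor _
        (X * (φ ⊗ₜ[k] (1 : DualAlg k H))))) h =
        ∑ i ∈ (ℛ k (1 : H)).index, ev2 X ((ℛ k (1 : H)).left i ⊗ₜ[k] h) *
          φ ((ℛ k (1 : H)).right i) := by
    intro X h
    induction X with
    | zero => simp
    | add X Y hX hY =>
      simp only [map_add, add_mul, LinearMap.add_apply, hX, hY,
        Finset.sum_add_distrib]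
    | tmul ψ χ =>
      simp only [Algebra.TensorProduct.tmul_mul_tmul, mul_one, LinearMap.rTensor_tmul,
        TensorProduct.lid_tmul, dual_counit, map_smul, LinearMap.smul_apply,
        smul_eq_mul, dual_mul_one_apply, ev2_tmul, Finset.sum_mul]
      exact Finset.sum_congr rfl fun i _ => by ring
  rw [targetCounit_apply (ℛ k (1 : H)), map_sum]
  refine (key _ h).trans (Finset.sum_congr rfl fun i _ => ?_)
  rw [ev2_comul, dual_one_apply, map_smul, smul_eq_mul]

/-- The source counital map of `H^*` is the transpose of that of `H`. -/
theorem dual_sourceCounit (φ : DualAlg k H) (h : H) :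
    sourceCounit k (DualAlg k H) φ h = φ (sourceCounit k H h) := by
  have key : ∀ (X : DualAlg k H ⊗[k] DualAlg k H) (h : H),
      (TensorProduct.rid k (DualAlg k H) ((counit (R := k)).lTensor _
        (((1 : DualAlg k H) ⊗ₜ[k] φ) * X))) h =
        ∑ i ∈ (ℛ k (1 : H)).index, ev2 X (h ⊗ₜ[k] (ℛ k (1 : H)).right i) *
          φ ((ℛ k (1 : H)).left i) := by
    intro X h
    induction X with
    | zero => simp
    | add X Y hX hY =>
      simp only [map_add, mul_add, add_mul, LinearMap.add_apply, hX, hY,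
        Finset.sum_add_distrib]
    | tmul ψ χ =>
      simp only [Algebra.TensorProduct.tmul_mul_tmul, one_mul, LinearMap.lTensor_tmul,
        TensorProduct.rid_tmul, dual_counit, map_smul, LinearMap.smul_apply,
        smul_eq_mul, dual_mul_one_apply, ev2_tmul, Finset.sum_mul]
      exact Finset.sum_congr rfl fun i _ => by ring
  rw [sourceCounit_apply (ℛ k (1 : H)), map_sum]
  refine (key _ h).trans (Finset.sum_congr rfl fun i _ => ?_)
  rw [ev2_comul, dual_one_apply, map_smul, smul_eq_mul]

theorem ev2_mul (X Y : DualAlg k H ⊗[k] DualAlg k H) (h g : H) :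
    ev2 (X * Y) (h ⊗ₜ[k] g) = ∑ i ∈ (ℛ k h).index, ∑ j ∈ (ℛ k g).index,
      ev2 X ((ℛ k h).left i ⊗ₜ[k] (ℛ k g).left j) *
        ev2 Y ((ℛ k h).right i ⊗ₜ[k] (ℛ k g).right j) := by
  induction X with
  | zero => simp
  | add X X' hX hY =>
    simp only [map_add, add_mul, LinearMap.add_apply, hX, hY, Finset.sum_add_distrib]
  | tmul φ ψ =>
    induction Y with
    | zero => simp
    | add X X' hX hY =>
      simp only [map_add, mul_add, LinearMap.add_apply, hX, hY, Finset.sum_add_distrib]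
    | tmul φ' ψ' =>
      rw [Algebra.TensorProduct.tmul_mul_tmul, ev2_tmul, dual_mul_apply (ℛ k h),
        dual_mul_apply (ℛ k g), Finset.sum_mul_sum]
      simp only [ev2_tmul]
      exact Finset.sum_congr rfl fun i _ => Finset.sum_congr rfl fun j _ => by ring

theorem ev3_mul_left (X Y : DualAlg k H ⊗[k] DualAlg k H) (h g f : H) :
    ev3 (TensorProduct.assoc k _ _ _ (X ⊗ₜ[k] (1 : DualAlg k H)) * ((1 : DualAlg k H) ⊗ₜ[k] Y))
      (h ⊗ₜ[k] (g ⊗ₜ[k] f)) = ∑ j ∈ (ℛ k g).index,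
        ev2 X (h ⊗ₜ[k] (ℛ k g).left j) * ev2 Y ((ℛ k g).right j ⊗ₜ[k] f) := by
  induction X with
  | zero => simp
  | add X X' hX hY =>
    simp only [map_add, add_mul, TensorProduct.add_tmul, LinearMap.add_apply, hX, hY,
      Finset.sum_add_distrib]
  | tmul φ ψ =>
    induction Y with
    | zero => simp
    | add X X' hX hY =>
      simp only [map_add, mul_add, TensorProduct.tmul_add, LinearMap.add_apply, hX, hY,
        Finset.sum_add_distrib]
    | tmul φ' ψ' =>
      rw [TensorProduct.assoc_tmul, Algebra.TensorProduct.tmul_mul_tmul,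
        Algebra.TensorProduct.tmul_mul_tmul, ev3_tmul, ev2_tmul, mul_one, one_mul,
        dual_mul_apply (ℛ k g), Finset.sum_mul, Finset.mul_sum]
      simp only [ev2_tmul]
      exact Finset.sum_congr rfl fun j _ => by ring

theorem ev3_mul_right (X Y : DualAlg k H ⊗[k] DualAlg k H) (h g f : H) :
    ev3 (((1 : DualAlg k H) ⊗ₜ[k] Y) * TensorProduct.assoc k _ _ _ (X ⊗ₜ[k] (1 : DualAlg k H)))
      (h ⊗ₜ[k] (g ⊗ₜ[k] f)) = ∑ j ∈ (ℛ k g).index,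
        ev2 Y ((ℛ k g).left j ⊗ₜ[k] f) * ev2 X (h ⊗ₜ[k] (ℛ k g).right j) := by
  induction X with
  | zero => simp
  | add X X' hX hY =>
    simp only [map_add, mul_add, TensorProduct.add_tmul, LinearMap.add_apply, hX, hY,
      Finset.sum_add_distrib]
  | tmul φ ψ =>
    induction Y with
    | zero => simp
    | add X X' hX hY =>
      simp only [map_add, add_mul, TensorProduct.tmul_add, LinearMap.add_apply, hX, hY,
        Finset.sum_add_distrib]
    | tmul φ' ψ' =>
      rw [TensorProduct.assoc_tmul, Algebra.TensorProduct.tmul_mul_tmul,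
        Algebra.TensorProduct.tmul_mul_tmul, ev3_tmul, ev2_tmul, mul_one, one_mul,
        dual_mul_apply (ℛ k g), Finset.sum_mul, Finset.mul_sum]
      simp only [ev2_tmul]
      exact Finset.sum_congr rfl fun j _ => by ring

variable [WeakHopfAlgebra k H]

/-- The transpose of the antipode: `⟨S(φ), h⟩ = ⟨φ, S(h)⟩`. -/
def dualAntipode : DualAlg k H →ₗ[k] DualAlg k H :=
  toLin.symm.toLinearMap ∘ₗ
    LinearMap.lcomp k k (WeakHopfAlgebra.antipode (k := k) (H := H)) ∘ₗ
    toLin.toLinearMap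

theorem dualAntipode_apply (φ : DualAlg k H) (h : H) :
    dualAntipode φ h = φ (WeakHopfAlgebra.antipode (k := k) h) := rfl

theorem dual_mul_antipode_aux (X : DualAlg k H ⊗[k] DualAlg k H) (h : H) :
    (LinearMap.mul' k (DualAlg k H) (dualAntipode.lTensor (DualAlg k H) X)) h =
      ev2 X ((WeakHopfAlgebra.antipode (k := k) (H := H)).lTensor H (comul (R := k) h)) := by
  induction X with
  | zero => simp
  | add X Y hX hY => simp only [map_add, LinearMap.add_apply, hX, hY]
  | tmul φ ψ =>
    rw [LinearMap.lTensor_tmul, LinearMap.mul'_apply, dual_mul_apply (ℛ k h)]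
    conv_rhs => rw [← (ℛ k h).eq]
    simp [dualAntipode_apply]

theorem dual_antipode_mul_aux (X : DualAlg k H ⊗[k] DualAlg k H) (h : H) :
    (LinearMap.mul' k (DualAlg k H) (dualAntipode.rTensor (DualAlg k H) X)) h =
      ev2 X ((WeakHopfAlgebra.antipode (k := k) (H := H)).rTensor H (comul (R := k) h)) := by
  induction X with
  | zero => simp
  | add X Y hX hY => simp only [map_add, LinearMap.add_apply, hX, hY]
  | tmul φ ψ =>
    rw [LinearMap.rTensor_tmul, LinearMap.mul'_apply, dual_mul_apply (ℛ k h)]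
    conv_rhs => rw [← (ℛ k h).eq]
    simp [dualAntipode_apply]

theorem ev2_comul' (φ : DualAlg k H) (t : H ⊗[k] H) :
    ev2 (comul (R := k) φ) t = φ (LinearMap.mul' k H t) := by
  induction t with
  | zero => simp
  | add X Y hX hY => simp only [map_add, hX, hY]
  | tmul a b => rw [ev2_comul, LinearMap.mul'_apply]

theorem dual_mul_antipode (φ : DualAlg k H) :
    LinearMap.mul' k (DualAlg k H) (dualAntipode.lTensor (DualAlg k H) (comul (R := k) φ)) =
      targetCounit k (DualAlg k H) φ := by
  ext h
  rw [dual_mul_antipode_aux, ev2_comul', WeakHopfAlgebra.mul_antipode, dual_targetCounit]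

/-- The dual quantum groupoid `H^*`. -/
instance : WeakHopfAlgebra k (DualAlg k H) where
  comul_mul φ ψ := by
    refine ev2_ext fun a b => ?_
    have e : comul (R := k) (a * b) = ∑ p ∈ (ℛ k a).index ×ˢ (ℛ k b).index,
        ((ℛ k a).left p.1 * (ℛ k b).left p.2) ⊗ₜ[k] ((ℛ k a).right p.1 * (ℛ k b).right p.2) := by
      rw [WeakHopfAlgebra.comul_mul, Finset.sum_product]
      conv_lhs => rw [← (ℛ k a).eq, ← (ℛ k b).eq]
      simp [Finset.sum_mul_sum]
    rw [ev2_comul, ev2_mul, dual_mul_apply (⟨_, _, _, e.symm⟩ : Coalgebra.Repr k (a * b) _),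
      Finset.sum_product]
    simp only [ev2_comul]
  counit_mul_mul φ ψ χ := by
    have key : ∀ X : DualAlg k H ⊗[k] DualAlg k H,
        LinearMap.mul' k k (TensorProduct.map (counit (R := k) ∘ₗ LinearMap.mulLeft k φ)
          (counit (R := k) ∘ₗ LinearMap.mulRight k χ) X) =
        ∑ i ∈ (ℛ k (1 : H)).index, ∑ j ∈ (ℛ k (1 : H)).index,
          φ ((ℛ k (1 : H)).left i) * (ev2 X ((ℛ k (1 : H)).right i ⊗ₜ[k] (ℛ k (1 : H)).left j) *
            χ ((ℛ k (1 : H)).right j)) := by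
      intro X
      induction X with
      | zero => simp
      | add X Y hX hY =>
        simp only [map_add, LinearMap.add_apply, hX, hY, mul_add, add_mul,
          Finset.sum_add_distrib]
      | tmul α β =>
        simp only [TensorProduct.map_tmul, LinearMap.comp_apply, LinearMap.mulLeft_apply,
          LinearMap.mulRight_apply, LinearMap.mul'_apply, dual_counit, dual_mul_one_apply,
          Finset.sum_mul_sum, ev2_tmul]
        exact Finset.sum_congr rfl fun i _ => Finset.sum_congr rfl fun j _ => by ring
    rw [key, mul_assoc, dual_counit, dual_mul_one_apply]
    have := congrArg ((TensorProduct.lid k k).toLinearMap ∘ₗ TensorProduct.map (toLin φ)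
      ((TensorProduct.lid k k).toLinearMap ∘ₗ TensorProduct.map (toLin ψ) (toLin χ)))
      (lTensor_comul_one (ℛ k (1 : H)))
    simp only [map_sum, LinearMap.comp_apply, TensorProduct.map_tmul, LinearEquiv.coe_coe,
      TensorProduct.lid_tmul, smul_eq_mul] at this
    simp only [ev2_comul]
    rw [← this]
    refine Finset.sum_congr rfl fun i _ => ?_
    rw [dual_mul_apply (ℛ k _)]
    conv_rhs => rw [← (ℛ k ((ℛ k (1 : H)).right i)).eq]
    simp
  counit_mul_mul' φ ψ χ := by
    have key : ∀ X : DualAlg k H ⊗[k] DualAlg k H,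
        LinearMap.mul' k k (TensorProduct.map (counit (R := k) ∘ₗ LinearMap.mulRight k χ)
          (counit (R := k) ∘ₗ LinearMap.mulLeft k φ) X) =
        ∑ i ∈ (ℛ k (1 : H)).index, ∑ j ∈ (ℛ k (1 : H)).index,
          φ ((ℛ k (1 : H)).left i) * (ev2 X ((ℛ k (1 : H)).left j ⊗ₜ[k] (ℛ k (1 : H)).right i) *
            χ ((ℛ k (1 : H)).right j)) := by
      intro X
      induction X with
      | zero => simp
      | add X Y hX hY =>
        simp only [map_add, LinearMap.add_apply, hX, hY, mul_add, add_mul,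
          Finset.sum_add_distrib]
      | tmul α β =>
        simp only [TensorProduct.map_tmul, LinearMap.comp_apply, LinearMap.mulLeft_apply,
          LinearMap.mulRight_apply, LinearMap.mul'_apply, dual_counit, dual_mul_one_apply,
          Finset.sum_mul_sum, ev2_tmul]
        rw [Finset.sum_comm]
        exact Finset.sum_congr rfl fun i _ => Finset.sum_congr rfl fun j _ => by ring
    rw [key, mul_assoc, dual_counit, dual_mul_one_apply]
    have := congrArg ((TensorProduct.lid k k).toLinearMap ∘ₗ TensorProduct.map (toLin φ)
      ((TensorProduct.lid k k).toLinearMap ∘ₗ TensorProduct.map (toLin ψ) (toLin χ)))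
      (lTensor_comul_one' (ℛ k (1 : H)))
    simp only [map_sum, LinearMap.comp_apply, TensorProduct.map_tmul, LinearEquiv.coe_coe,
      TensorProduct.lid_tmul, smul_eq_mul] at this
    simp only [ev2_comul]
    rw [← this]
    refine Finset.sum_congr rfl fun i _ => ?_
    rw [dual_mul_apply (ℛ k _)]
    conv_rhs => rw [← (ℛ k ((ℛ k (1 : H)).right i)).eq]
    simp
  comul_comul_one := by
    refine ev3_ext fun a b c => ?_
    rw [ev3_assoc_rTensor_comul, ev3_mul_left, ev2_comul, dual_one_apply,
      WeakHopfAlgebra.counit_mul_mul]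
    conv_lhs => rw [← (ℛ k b).eq]
    simp [ev2_comul, dual_one_apply]
  comul_comul_one' := by
    refine ev3_ext fun a b c => ?_
    rw [ev3_assoc_rTensor_comul, ev3_mul_right, ev2_comul, dual_one_apply,
      WeakHopfAlgebra.counit_mul_mul']
    conv_lhs => rw [← (ℛ k b).eq]
    simp [ev2_comul, dual_one_apply]
  antipode := dualAntipode
  mul_antipode := dual_mul_antipode
  antipode_mul φ := by
    ext h
    rw [dual_antipode_mul_aux, ev2_comul', WeakHopfAlgebra.antipode_mul, dual_sourceCounit]
  antipode_mul_antipode φ := by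
    have key : ∀ (X : DualAlg k H ⊗[k] DualAlg k H) (h : H),
        (LinearMap.mul' k (DualAlg k H) (TensorProduct.map dualAntipode
          (LinearMap.mul' k (DualAlg k H) ∘ₗ dualAntipode.lTensor (DualAlg k H) ∘ₗ
            comul (R := k)) X)) h =
        ev2 X (TensorProduct.map (WeakHopfAlgebra.antipode (k := k) (H := H))
          (LinearMap.mul' k H ∘ₗ (WeakHopfAlgebra.antipode (k := k)).lTensor H ∘ₗ
            comul (R := k)) (comul (R := k) h)) := by
      intro X h
      induction X with
      | zero => simp
      | add X Y hX hY => simp only [map_add, LinearMap.add_apply, hX, hY]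
      | tmul φ ψ =>
        rw [TensorProduct.map_tmul, LinearMap.mul'_apply, dual_mul_apply (ℛ k h)]
        conv_rhs => rw [← (ℛ k h).eq]
        simp only [map_sum, TensorProduct.map_tmul, ev2_tmul, dualAntipode_apply,
          LinearMap.comp_apply, dual_mul_antipode, dual_targetCounit,
          WeakHopfAlgebra.mul_antipode]
    ext h
    rw [key, ev2_comul', WeakHopfAlgebra.antipode_mul_antipode, dualAntipode_apply]

end Dual

section DualAction

variable {k : Type u} {A : Type w} {H : Type v} [Field k] [Ring H] [Algebra k H] [Coalgebra k H]

/-- The action `φ ⇀ h = h₁⟨φ, h₂⟩` of `H^*` on `H`. -/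
def hit (φ : DualAlg k H) : H →ₗ[k] H :=
  (TensorProduct.rid k H).toLinearMap ∘ₗ (toLin φ).lTensor H ∘ₗ comul (R := k)

theorem hit_apply {ι : Type*} {h : H} (r : Coalgebra.Repr k h ι) (φ : DualAlg k H) :
    hit φ h = ∑ i ∈ r.index, φ (r.right i) • r.left i := by
  simp [hit, ← r.eq]

theorem hit_one (h : H) : hit (1 : DualAlg k H) h = h := by
  have := Coalgebra.lTensor_counit_comul (R := k) h
  have e := congrArg (TensorProduct.rid k H) this
  rw [TensorProduct.rid_tmul, one_smul] at e
  exact e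

theorem hit_mul (φ ψ : DualAlg k H) (h : H) : hit (φ * ψ) h = hit φ (hit ψ h) := by
  have hc := congrArg ((TensorProduct.rid k H).toLinearMap ∘ₗ TensorProduct.map LinearMap.id
      ((TensorProduct.lid k k).toLinearMap ∘ₗ TensorProduct.map (toLin φ) (toLin ψ)))
    (Coalgebra.sum_tmul_tmul_eq (ℛ k h) (fun i => ℛ k ((ℛ k h).left i))
        (fun i => ℛ k ((ℛ k h).right i)))
  simp only [map_sum, LinearMap.comp_apply, TensorProduct.map_tmul, LinearEquiv.coe_coe,
    TensorProduct.lid_tmul, TensorProduct.rid_tmul, smul_eq_mul, LinearMap.id_apply] at hc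
  rw [hit_apply (ℛ k h), hit_apply (ℛ k h), map_sum]
  calc _ = _ := ?_
    _ = _ := hc.symm
    _ = _ := ?_
  · refine Finset.sum_congr rfl fun i _ => ?_
    rw [dual_mul_apply (ℛ k _), Finset.sum_smul]
  · refine Finset.sum_congr rfl fun i _ => ?_
    rw [map_smul, hit_apply (ℛ k _), Finset.smul_sum]
    refine Finset.sum_congr rfl fun j _ => ?_
    rw [smul_smul, mul_comm]

theorem hit_target_mul [WeakHopfAlgebra k H] (φ : DualAlg k H) {z : H}
    (hz : targetCounit k H z = z) (h : H) : hit φ (z * h) = z * hit φ h := by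
  have e : comul (R := k) (z * h) = ∑ i ∈ (ℛ k h).index,
      (z * (ℛ k h).left i) ⊗ₜ[k] (ℛ k h).right i := by
    rw [comul_target_mul hz, ← (ℛ k h).eq, Finset.mul_sum]
    simp
  rw [hit_apply (⟨_, _, _, e.symm⟩ : Coalgebra.Repr k (z * h) _), hit_apply (ℛ k h),
    Finset.mul_sum]
  simp

variable [Ring A] [Algebra k A] [Module H A]
variable [WeakHopfAlgebra k H]

namespace SmashProduct

/-- The endomorphism `x # h ↦ x # (φ ⇀ h)` of `A # H`. -/
def dualAct (φ : DualAlg k H) : SmashProduct k A H →ₗ[k] SmashProduct k A H :=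
  liftLin (proj k A H ∘ₗ (hit φ).lTensor A) (fun x z h hz => by
    simp [proj_tmul, hit_target_mul φ hz, mk_balanced x hz])

theorem dualAct_mk (φ : DualAlg k H) (x : A) (h : H) :
    dualAct φ (mk k x h) = mk k x (hit φ h) := rfl

theorem hit_add (φ ψ : DualAlg k H) : hit (φ + ψ) = hit φ + hit ψ := by
  ext h
  simp [hit_apply (ℛ k h), add_smul, Finset.sum_add_distrib]

theorem hit_smul (c : k) (φ : DualAlg k H) : hit (c • φ) = c • hit φ := by
  ext h
  simp [hit_apply (ℛ k h), mul_smul, Finset.smul_sum]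

theorem mk_add (x : A) (h g : H) : mk k x (h + g) = mk k x h + mk k x g := by
  simp only [← proj_tmul, TensorProduct.tmul_add, map_add]

theorem mk_smul (c : k) (x : A) (h : H) : mk k x (c • h) = c • mk k x h := by
  simp only [← proj_tmul, TensorProduct.tmul_smul, map_smul]

theorem mk_sum {ι : Type*} (s : Finset ι) (x : A) (f : ι → H) :
    mk k x (∑ i ∈ s, f i) = ∑ i ∈ s, mk k x (f i) := by
  simp only [← proj_tmul, TensorProduct.tmul_sum, map_sum]

/-- The action of `H^*` on `A # H`: `φ·(x # h) = x # (φ ⇀ h)`. -/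
instance : Module (DualAlg k H) (SmashProduct k A H) where
  smul φ u := dualAct φ u
  one_smul u := by
    change dualAct 1 u = u
    induction u using induction_on with
    | zero => simp
    | add u v hu hv => rw [map_add, hu, hv]
    | mk x h => rw [dualAct_mk, hit_one]
  mul_smul φ ψ u := by
    change dualAct (φ * ψ) u = dualAct φ (dualAct ψ u)
    induction u using induction_on with
    | zero => simp
    | add u v hu hv => simp only [map_add, hu, hv]
    | mk x h => simp only [dualAct_mk, hit_mul]
  smul_zero φ := map_zero (dualAct φ)
  smul_add φ := map_add (dualAct φ)
  add_smul φ ψ u := by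
    change dualAct (φ + ψ) u = dualAct φ u + dualAct ψ u
    induction u using induction_on with
    | zero => simp
    | add u v hu hv => simp only [map_add, hu, hv]; abel
    | mk x h => simp only [dualAct_mk, hit_add, LinearMap.add_apply, mk_add]
  zero_smul u := by
    change dualAct 0 u = 0
    have h0 : hit (0 : DualAlg k H) = 0 := by simpa using hit_smul (0 : k) (0 : DualAlg k H)
    induction u using induction_on with
    | zero => simp
    | add u v hu hv => simp only [map_add, hu, hv, add_zero]
    | mk x h => rw [dualAct_mk, h0, LinearMap.zero_apply, ← proj_tmul, TensorProduct.tmul_zero,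
        map_zero]

theorem dual_smul_mk (φ : DualAlg k H) (x : A) (h : H) : φ • mk k x h = mk k x (hit φ h) := rfl

instance : IsScalarTower k (DualAlg k H) (SmashProduct k A H) where
  smul_assoc c φ u := by
    change dualAct (c • φ) u = c • dualAct φ u
    induction u using induction_on with
    | zero => simp
    | add u v hu hv => simp only [map_add, hu, hv, smul_add]
    | mk x h => simp only [dualAct_mk, hit_smul, LinearMap.smul_apply, mk_smul]

variable [FiniteDimensional k H] [IsScalarTower k H A] [ModuleAlgebra k H A]

theorem hit_mul_apply (φ : DualAlg k H) (a b : H) :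
    hit φ (a * b) = ∑ i ∈ (ℛ k a).index, ∑ j ∈ (ℛ k b).index,
      φ ((ℛ k a).right i * (ℛ k b).right j) • ((ℛ k a).left i * (ℛ k b).left j) := by
  have e : comul (R := k) (a * b) = ∑ p ∈ (ℛ k a).index ×ˢ (ℛ k b).index,
      ((ℛ k a).left p.1 * (ℛ k b).left p.2) ⊗ₜ[k] ((ℛ k a).right p.1 * (ℛ k b).right p.2) := by
    rw [WeakHopfAlgebra.comul_mul, Finset.sum_product]
    conv_lhs => rw [← (ℛ k a).eq, ← (ℛ k b).eq]
    simp [Finset.sum_mul_sum]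
  rw [hit_apply (⟨_, _, _, e.symm⟩ : Coalgebra.Repr k (a * b) _), Finset.sum_product]

theorem dual_smul_mul_aux (X : DualAlg k H ⊗[k] DualAlg k H) (x y : A) (h g : H) :
    LinearMap.mul' k (SmashProduct k A H) (TensorProduct.map
      ((LinearMap.toSpanSingleton (DualAlg k H) _ (mk k x h)).restrictScalars k)
      ((LinearMap.toSpanSingleton (DualAlg k H) _ (mk k y g)).restrictScalars k) X) =
    ∑ i ∈ (ℛ k h).index, ∑ j ∈ (ℛ k ((ℛ k h).right i)).index, ∑ l ∈ (ℛ k g).index,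
      ev2 X ((ℛ k ((ℛ k h).right i)).right j ⊗ₜ[k] (ℛ k g).right l) •
        mk k (x * (ℛ k h).left i • y) ((ℛ k ((ℛ k h).right i)).left j * (ℛ k g).left l) := by
  induction X with
  | zero => simp
  | add X Y hX hY =>
    simp only [map_add, LinearMap.add_apply, hX, hY, add_smul, Finset.sum_add_distrib]
  | tmul φ ψ =>
    rw [TensorProduct.map_tmul, LinearMap.mul'_apply, LinearMap.restrictScalars_apply,
      LinearMap.restrictScalars_apply, LinearMap.toSpanSingleton_apply,
      LinearMap.toSpanSingleton_apply, dual_smul_mk, dual_smul_mk]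
    have hc := congrArg (proj k A H ∘ₗ TensorProduct.map
        (LinearMap.mul k A x ∘ₗ (LinearMap.toSpanSingleton H A y).restrictScalars k)
        (LinearMap.mulRight k (hit ψ g) ∘ₗ (TensorProduct.rid k H).toLinearMap ∘ₗ
          (toLin φ).lTensor H))
      (Coalgebra.sum_tmul_tmul_eq (ℛ k h) (fun i => ℛ k ((ℛ k h).left i))
        (fun i => ℛ k ((ℛ k h).right i)))
    simp only [map_sum, LinearMap.comp_apply, TensorProduct.map_tmul, LinearEquiv.coe_coe,
      LinearMap.lTensor_tmul, TensorProduct.rid_tmul,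
      LinearMap.mulRight_apply, LinearMap.restrictScalars_apply, LinearMap.mul_apply',
      LinearMap.toSpanSingleton_apply, proj_tmul] at hc
    calc _ = _ := ?_
      _ = _ := hc
      _ = _ := ?_
    · rw [hit_apply (ℛ k h), mk_sum, Finset.sum_mul]
      refine Finset.sum_congr rfl fun i _ => ?_
      rw [mk_smul, smul_mul_assoc, mk_mul_mk _ _ _ (ℛ k _), Finset.smul_sum]
      refine Finset.sum_congr rfl fun j _ => ?_
      rw [smul_mul_assoc, mk_smul]
    · refine Finset.sum_congr rfl fun i _ => Finset.sum_congr rfl fun j _ => ?_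
      rw [hit_apply (ℛ k g), Finset.mul_sum, mk_sum]
      refine Finset.sum_congr rfl fun l _ => ?_
      rw [smul_mul_smul_comm, mk_smul, ev2_tmul]

theorem hit_targetCounit_one (φ : DualAlg k H) :
    hit (targetCounit k (DualAlg k H) φ) (1 : H) = hit φ 1 := by
  have hc := congrArg ((TensorProduct.rid k H).toLinearMap ∘ₗ (toLin φ).lTensor H)
    (sum_tmul_targetCounit (ℛ k (1 : H)))
  simp only [map_sum, LinearMap.comp_apply, LinearEquiv.coe_coe,
      LinearMap.lTensor_tmul, TensorProduct.rid_tmul] at hc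
  rw [hit_apply (ℛ k 1), hit_apply (ℛ k 1)]
  simpa only [dual_targetCounit] using hc

/-- `A # H` is a left `H^*`-module algebra. -/
instance : ModuleAlgebra k (DualAlg k H) (SmashProduct k A H) where
  smul_mul φ u v := by
    induction u using induction_on with
    | zero => simp [LinearMap.toSpanSingleton_zero]
    | add u u' hu hu' =>
      simp only [add_mul, smul_add, LinearMap.toSpanSingleton_add, hu, hu',
        LinearMap.restrictScalars_add, TensorProduct.map_add_left, LinearMap.add_apply, map_add]
    | mk x h =>
      induction v using induction_on with
      | zero => simp [LinearMap.toSpanSingleton_zero]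
      | add u u' hu hu' =>
        simp only [mul_add, smul_add, LinearMap.toSpanSingleton_add, hu, hu',
          LinearMap.restrictScalars_add, TensorProduct.map_add_right, LinearMap.add_apply, map_add]
      | mk y g =>
        rw [dual_smul_mul_aux, mk_mul_mk _ _ _ (ℛ k h), Finset.smul_sum]
        refine Finset.sum_congr rfl fun i _ => ?_
        rw [dual_smul_mk, hit_mul_apply, mk_sum]
        refine Finset.sum_congr rfl fun j _ => ?_
        rw [mk_sum]
        refine Finset.sum_congr rfl fun l _ => ?_
        rw [mk_smul, ev2_comul]
  smul_one φ := by
    rw [one_def, dual_smul_mk, dual_smul_mk, hit_targetCounit_one]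

end SmashProduct

end DualAction

end

end QuantumGroupoid

/-! The map α sends u # φ to w ↦ u(φ·w). It is well defined and multiplicative for the same reason
that any smash product B # K acts on B. Its values are right A-linear because H^* acts through the
last leg of Δ, while right multiplication by w # 1 acts through the first.

The content lies in the inverse. To an endomorphism T attach c_T(h) = T(1 # h₂)(1 # S⁻¹(h₁)), which
is `coefficient`. Two computations carry the proof.

First, c_T(g₂)(y # g₁) = T(y # g) (`sum_coefficient_end_mul_mk`). The inner sum (1 # S⁻¹(g₂))(y #
g₁) lies in A # 1, so right linearity pulls it inside T, and what remains is the case T = id.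
Expanding c_T in a basis of H, this says that α(Σ c_T(fᵢ) # ψᵢ) = T.

Second, for T = α(u # φ) one finds c_T(h) = u(1 # 1₁)⟨φ, 1₂h⟩ (`coefficient_toEnd`). Hence Σ c_T(fᵢ)
# ψᵢ = u(φ₁·1) # φ₂ = u # ε_t(φ₁)φ₂ = u # φ.

All this needs S⁻¹ and its behaviour under products and coproducts. S is antimultiplicative because
S(hg) and S(g)S(h) are both weak convolution inverses of the product (`antipode_mul_rev`); the same
theorem in H^* makes it anticomultiplicative. Injectivity comes from the Fitting decomposition H =
ker Sⁿ ⊕ im Sⁿ: the projection to the image commutes with left multiplication by elements of im Sⁿ,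
and a convolution argument (`commute_of_commute_antipode`) extends this to all of H. The projection
fixes 1, so it is the identity and the kernel vanishes. -/

namespace QuantumGroupoid

open Coalgebra TensorProduct LinearMap

universe u v w

noncomputable section

/-! ### The source counital map, and its interplay with the target counital map. -/

section Source

variable {k : Type u} {H : Type v} [Field k] [Ring H] [Algebra k H] [Coalgebra k H]
  [WeakHopfAlgebra k H]

/-- `1₁ ⊗ 1₂ ⊗ 1₃ = 1₁ ⊗ 1₂1₁' ⊗ 1₂'`. -/
theorem rTensor_comul_one {ι : Type*} (r : Coalgebra.Repr k (1 : H) ι) :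
    ∑ i ∈ r.index, comul (R := k) (r.left i) ⊗ₜ[k] r.right i =
      ∑ i ∈ r.index, ∑ j ∈ r.index,
        (r.left i ⊗ₜ[k] (r.right i * r.left j)) ⊗ₜ[k] r.right j := by
  have := congrArg (TensorProduct.assoc k H H H).symm
    (WeakHopfAlgebra.comul_comul_one (k := k) (H := H))
  rw [← r.eq] at this
  rw [Finset.sum_comm]
  simpa [TensorProduct.sum_tmul, TensorProduct.tmul_sum, Finset.sum_mul, Finset.mul_sum]
    using this

/-- `1₁ ⊗ 1₂ ⊗ 1₃ = 1₁ ⊗ 1₁'1₂ ⊗ 1₂'`. -/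
theorem rTensor_comul_one' {ι : Type*} (r : Coalgebra.Repr k (1 : H) ι) :
    ∑ i ∈ r.index, comul (R := k) (r.left i) ⊗ₜ[k] r.right i =
      ∑ i ∈ r.index, ∑ j ∈ r.index,
        (r.left i ⊗ₜ[k] (r.left j * r.right i)) ⊗ₜ[k] r.right j := by
  have := congrArg (TensorProduct.assoc k H H H).symm
    (WeakHopfAlgebra.comul_comul_one' (k := k) (H := H))
  rw [← r.eq] at this
  simpa [TensorProduct.sum_tmul, TensorProduct.tmul_sum, Finset.sum_mul, Finset.mul_sum]
    using this

/-- `1₁ ⊗ 1₂1₁' ⊗ 1₂' = 1₁ ⊗ 1₁'1₂ ⊗ 1₂'`. -/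
theorem sum_comul_one_mul_comm {ι : Type*} (r : Coalgebra.Repr k (1 : H) ι) :
    ∑ i ∈ r.index, ∑ j ∈ r.index, (r.left i ⊗ₜ[k] (r.right i * r.left j)) ⊗ₜ[k] r.right j =
      ∑ i ∈ r.index, ∑ j ∈ r.index,
        (r.left i ⊗ₜ[k] (r.left j * r.right i)) ⊗ₜ[k] r.right j := by
  rw [← rTensor_comul_one, rTensor_comul_one']

/-- `ε_s(1₁) ⊗ 1₂ = 1₁ ⊗ 1₂`. -/
theorem sum_sourceCounit_tmul {ι : Type*} (r : Coalgebra.Repr k (1 : H) ι) :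
    ∑ i ∈ r.index, sourceCounit k H (r.left i) ⊗ₜ[k] r.right i =
      ∑ i ∈ r.index, r.left i ⊗ₜ[k] r.right i := by
  have := congrArg (((TensorProduct.rid k H).toLinearMap ∘ₗ
    (counit (R := k) (A := H)).lTensor H).rTensor H) (rTensor_comul_one' r)
  simp only [map_sum, LinearMap.lTensor_tmul, LinearMap.comp_apply,
    Coalgebra.lTensor_counit_comul, LinearEquiv.coe_coe, TensorProduct.rid_tmul, one_smul,
    LinearMap.rTensor_tmul] at this
  rw [this, Finset.sum_comm]
  refine Finset.sum_congr rfl fun i _ => ?_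
  rw [sourceCounit_apply r, TensorProduct.sum_tmul]

/-- The values of ε_s are combinations of left legs of Δ(1), and ε_s fixes those legs. -/
theorem sourceCounit_sourceCounit (h : H) :
    sourceCounit k H (sourceCounit k H h) = sourceCounit k H h := by
  have := congrArg ((TensorProduct.rid k H).toLinearMap ∘ₗ
    (counit (R := k) (A := H) ∘ₗ LinearMap.mulLeft k h).lTensor H)
    (sum_sourceCounit_tmul (ℛ k (1 : H)))
  rw [sourceCounit_apply (ℛ k (1 : H)) h, map_sum]
  simpa using this

/-- `Δ(w) = 1₁ ⊗ 1₂w` for `w ∈ H_s`. -/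
theorem comul_source {w : H} (hw : sourceCounit k H w = w) :
    comul (R := k) w = comul (R := k) (1 : H) * (1 ⊗ₜ[k] w) := by
  have := congrArg ((TensorProduct.rid k (H ⊗[k] H)).toLinearMap ∘ₗ
    (counit (R := k) (A := H) ∘ₗ LinearMap.mulLeft k w).lTensor (H ⊗[k] H))
    ((rTensor_comul_one (ℛ k (1 : H))).trans Finset.sum_comm)
  conv_lhs => rw [← hw]
  conv_rhs => rw [← hw]
  conv_rhs => rw [← (ℛ k (1 : H)).eq]
  rw [sourceCounit_apply (ℛ k (1 : H)) w, map_sum]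
  simpa [TensorProduct.tmul_sum, TensorProduct.sum_tmul, Finset.mul_sum, Finset.sum_mul,
    TensorProduct.smul_tmul'] using this

/-- `Δ(w) = 1₁ ⊗ w1₂` for `w ∈ H_s`. -/
theorem comul_source' {w : H} (hw : sourceCounit k H w = w) :
    comul (R := k) w = (1 ⊗ₜ[k] w) * comul (R := k) (1 : H) := by
  have := congrArg ((TensorProduct.rid k (H ⊗[k] H)).toLinearMap ∘ₗ
    (counit (R := k) (A := H) ∘ₗ LinearMap.mulLeft k w).lTensor (H ⊗[k] H))
    (rTensor_comul_one' (ℛ k (1 : H)))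
  conv_lhs => rw [← hw]
  conv_rhs => rw [← hw]
  conv_rhs => rw [← (ℛ k (1 : H)).eq]
  rw [sourceCounit_apply (ℛ k (1 : H)) w, map_sum]
  simpa [TensorProduct.tmul_sum, TensorProduct.sum_tmul, Finset.mul_sum, Finset.sum_mul,
    TensorProduct.smul_tmul'] using this

/-- `Δ(wh) = h₁ ⊗ wh₂` for `w ∈ H_s`. -/
theorem comul_source_mul {w : H} (hw : sourceCounit k H w = w) (h : H) :
    comul (R := k) (w * h) = (1 ⊗ₜ[k] w) * comul (R := k) h := by
  rw [WeakHopfAlgebra.comul_mul, comul_source' hw, mul_assoc, ← WeakHopfAlgebra.comul_mul, one_mul]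

/-- `h₁ε_s(h₂) = h`. -/
theorem sum_mul_sourceCounit {ι : Type*} {h : H} (r : Coalgebra.Repr k h ι) :
    ∑ i ∈ r.index, r.left i * sourceCounit k H (r.right i) = h := by
  have key : ∀ X : H ⊗[k] H, LinearMap.mul' k H ((sourceCounit k H).lTensor H X) =
      TensorProduct.rid k H ((counit (R := k) (A := H)).lTensor H (X * comul (R := k) (1 : H))) := by
    intro X
    induction X with
    | zero => simp
    | add X Y hX hY => simp [add_mul, hX, hY]
    | tmul x y =>
      rw [← (ℛ k (1 : H)).eq]
      simp [sourceCounit_apply (ℛ k (1 : H)), Finset.mul_sum]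
  have := key (comul (R := k) h)
  rw [← WeakHopfAlgebra.comul_mul, mul_one] at this
  rw [Coalgebra.lTensor_counit_comul, ← r.eq] at this
  simpa using this

/-- This is weak multiplicativity of ε with middle factor 1. The primed version uses the other order
of the legs. -/
theorem counit_mul_eq_sum {ι : Type*} (r : Coalgebra.Repr k (1 : H) ι) (h g : H) :
    counit (R := k) (h * g) = ∑ i ∈ r.index,
      counit (R := k) (h * r.left i) * counit (R := k) (r.right i * g) := by
  have := WeakHopfAlgebra.counit_mul_mul (k := k) h 1 g
  rw [← r.eq, mul_one] at this
  simpa using this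

theorem counit_mul_eq_sum' {ι : Type*} (r : Coalgebra.Repr k (1 : H) ι) (h g : H) :
    counit (R := k) (h * g) = ∑ i ∈ r.index,
      counit (R := k) (r.left i * g) * counit (R := k) (h * r.right i) := by
  have := WeakHopfAlgebra.counit_mul_mul' (k := k) h 1 g
  rw [← r.eq, mul_one] at this
  simpa using this

theorem counit_mul_targetCounit (h g : H) :
    counit (R := k) (h * targetCounit k H g) = counit (R := k) (h * g) := by
  rw [counit_mul_eq_sum' (ℛ k (1 : H)) h g, targetCounit_apply (ℛ k (1 : H)), Finset.mul_sum,
    map_sum]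
  simp

theorem counit_sourceCounit_mul (h g : H) :
    counit (R := k) (sourceCounit k H h * g) = counit (R := k) (h * g) := by
  rw [counit_mul_eq_sum' (ℛ k (1 : H)) h g, sourceCounit_apply (ℛ k (1 : H)), Finset.sum_mul,
    map_sum]
  simp [mul_comm]

/-- ε_t sees its argument only through the functionals ε(1₁·), and under these g may be replaced by
ε_t(g). -/
theorem targetCounit_mul_targetCounit (h g : H) :
    targetCounit k H (h * targetCounit k H g) = targetCounit k H (h * g) := by
  simp only [targetCounit_apply (ℛ k (1 : H)) (h * _), ← mul_assoc, counit_mul_targetCounit]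

theorem sourceCounit_sourceCounit_mul (h g : H) :
    sourceCounit k H (sourceCounit k H h * g) = sourceCounit k H (h * g) := by
  simp only [sourceCounit_apply (ℛ k (1 : H)) (_ * g), mul_assoc, counit_sourceCounit_mul]

theorem targetCounit_one : targetCounit k H (1 : H) = 1 := by
  rw [targetCounit_apply (ℛ k (1 : H))]
  simpa using Coalgebra.sum_counit_smul (ℛ k (1 : H))

theorem sourceCounit_one : sourceCounit k H (1 : H) = 1 := by
  have := congrArg (TensorProduct.rid k H) (Coalgebra.lTensor_counit_comul (R := k) (1 : H))
  rw [← (ℛ k (1 : H)).eq] at this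
  simp only [map_sum, LinearMap.lTensor_tmul, TensorProduct.rid_tmul, one_smul] at this
  simpa only [sourceCounit_apply (ℛ k (1 : H)), one_mul] using this

/-- The two forms of the axiom for (Δ ⊗ id)Δ(1) differ only in the order of the product in the
middle leg. Evaluating the outer legs with ε(·h) and ε(g·) turns the middle leg into a product of
ε_t(h) and ε_s(g), in either order. -/
theorem targetCounit_mul_sourceCounit_comm (h g : H) :
    targetCounit k H h * sourceCounit k H g = sourceCounit k H g * targetCounit k H h := by
  have := congrArg ((TensorProduct.rid k H).toLinearMap ∘ₗ TensorProduct.map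
    ((TensorProduct.lid k H).toLinearMap ∘ₗ
      (counit (R := k) (A := H) ∘ₗ LinearMap.mulRight k h).rTensor H)
    (counit (R := k) (A := H) ∘ₗ LinearMap.mulLeft k g)) (sum_comul_one_mul_comm (ℛ k (1 : H)))
  simp only [map_sum, LinearMap.comp_apply, TensorProduct.map_tmul, LinearMap.rTensor_tmul,
    LinearEquiv.coe_coe, LinearMap.mulRight_apply, LinearMap.mulLeft_apply,
    TensorProduct.lid_tmul, TensorProduct.rid_tmul] at this
  rw [targetCounit_apply (ℛ k (1 : H)), sourceCounit_apply (ℛ k (1 : H)), Finset.sum_mul_sum,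
    Finset.sum_mul_sum]
  refine Eq.trans ?_ (this.trans (Finset.sum_comm.trans ?_)) <;>
    refine Finset.sum_congr rfl fun i _ => Finset.sum_congr rfl fun j _ => ?_
  · rw [smul_mul_smul_comm, smul_smul, mul_comm (counit (R := k) _)]
  · rw [smul_mul_smul_comm, smul_smul]

end Source

/-! ### Convolution identities for the antipode, and antimultiplicativity. -/

section Antipode

variable {k : Type u} {H : Type v} [Field k] [Ring H] [Algebra k H] [Coalgebra k H]
  [WeakHopfAlgebra k H]

open WeakHopfAlgebra WithConv

theorem sum_mul_antipode {ι : Type*} {h : H} (r : Coalgebra.Repr k h ι) :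
    ∑ i ∈ r.index, r.left i * antipode (k := k) (r.right i) = targetCounit k H h := by
  rw [← mul_antipode, ← r.eq]
  simp

theorem sum_antipode_mul {ι : Type*} {h : H} (r : Coalgebra.Repr k h ι) :
    ∑ i ∈ r.index, antipode (k := k) (r.left i) * r.right i = sourceCounit k H h := by
  rw [← antipode_mul, ← r.eq]
  simp

theorem sum_antipode_mul_targetCounit {ι : Type*} {h : H} (r : Coalgebra.Repr k h ι) :
    ∑ i ∈ r.index, antipode (k := k) (r.left i) * targetCounit k H (r.right i) =
      antipode (k := k) h := by
  rw [← antipode_mul_antipode, ← r.eq]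
  simp [mul_antipode]

/-- `S` as an element of the convolution algebra. -/
theorem conv_antipode_mul_id :
    toConv (antipode (k := k) (H := H)) * toConv LinearMap.id = toConv (sourceCounit k H) := by
  ext h
  exact ((ℛ k h).convMul_apply _ _).trans (sum_antipode_mul (ℛ k h))

theorem conv_id_mul_antipode :
    toConv LinearMap.id * toConv (antipode (k := k) (H := H)) = toConv (targetCounit k H) := by
  ext h
  exact ((ℛ k h).convMul_apply _ _).trans (sum_mul_antipode (ℛ k h))

theorem conv_antipode_mul_targetCounit :
    toConv (antipode (k := k) (H := H)) * toConv (targetCounit k H) = toConv antipode := by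
  ext h
  exact ((ℛ k h).convMul_apply _ _).trans (sum_antipode_mul_targetCounit (ℛ k h))

/-- In the convolution algebra ε_s * S = S * id * S = S * ε_t = S. -/
theorem sum_sourceCounit_mul_antipode {ι : Type*} {h : H} (r : Coalgebra.Repr k h ι) :
    ∑ i ∈ r.index, sourceCounit k H (r.left i) * antipode (k := k) (r.right i) =
      antipode (k := k) h := by
  have e : toConv (sourceCounit k H) * toConv antipode = toConv (antipode (k := k) (H := H)) := by
    rw [← conv_antipode_mul_id, mul_assoc, conv_id_mul_antipode, conv_antipode_mul_targetCounit]
  exact (r.convMul_apply _ _).symm.trans (congrArg (fun f => f.ofConv h) e)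

/-- A Sweedler representation of `Δ(hg) = Δ(h)Δ(g)`. -/
def reprMul {ι κ : Type*} {h g : H} (r : Coalgebra.Repr k h ι) (s : Coalgebra.Repr k g κ) :
    Coalgebra.Repr k (h * g) (ι × κ) where
  index := r.index ×ˢ s.index
  left p := r.left p.1 * s.left p.2
  right p := r.right p.1 * s.right p.2
  eq := by
    rw [comul_mul, ← r.eq, ← s.eq, Finset.sum_mul_sum, Finset.sum_product]
    simp

/-- `h₁zS(h₂) = ε_t(hz)` for `z ∈ H_t`. -/
theorem sum_mul_target_mul_antipode {ι : Type*} {h : H} (r : Coalgebra.Repr k h ι) {z : H}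
    (hz : targetCounit k H z = z) :
    ∑ i ∈ r.index, r.left i * z * antipode (k := k) (r.right i) = targetCounit k H (h * z) :=
  sum_mul_antipode (h := h * z)
    (⟨r.index, fun i => r.left i * z, r.right, by
      rw [comul_mul_target hz, ← r.eq, Finset.sum_mul]; simp⟩ : Coalgebra.Repr k (h * z) ι)

/-- `S(h₁)wh₂ = ε_s(wh)` for `w ∈ H_s`. -/
theorem sum_antipode_mul_source_mul {ι : Type*} {h : H} (r : Coalgebra.Repr k h ι) {w : H}
    (hw : sourceCounit k H w = w) :
    ∑ i ∈ r.index, antipode (k := k) (r.left i) * w * r.right i = sourceCounit k H (w * h) := by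
  simp only [mul_assoc]
  exact sum_antipode_mul (h := w * h)
    (⟨r.index, r.left, fun i => w * r.right i, by
      rw [comul_source_mul hw, ← r.eq, Finset.mul_sum]; simp⟩ : Coalgebra.Repr k (w * h) ι)

/-- `ε_s(wh₁)S(h₂) = S(h)w` for `w ∈ H_s`. -/
theorem sum_sourceCounit_source_mul_mul_antipode {ι : Type*} {h : H} (r : Coalgebra.Repr k h ι)
    {w : H} (hw : sourceCounit k H w = w) :
    ∑ i ∈ r.index, sourceCounit k H (w * r.left i) * antipode (k := k) (r.right i) =
      antipode (k := k) h * w := by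
  have e1 : toConv (antipode (k := k) (H := H)) * toConv (LinearMap.mulLeft k w) =
      toConv (sourceCounit k H ∘ₗ LinearMap.mulLeft k w) := by
    ext h
    refine ((ℛ k h).convMul_apply _ _).trans (Eq.trans ?_ (sum_antipode_mul_source_mul (ℛ k h) hw))
    simp [mul_assoc]
  have e2 : toConv (LinearMap.mulLeft k w) * toConv (antipode (k := k) (H := H)) =
      toConv (LinearMap.mulLeft k w ∘ₗ targetCounit k H) := by
    ext h
    refine ((ℛ k h).convMul_apply _ _).trans ?_
    simp [mul_assoc, ← sum_mul_antipode (ℛ k h)]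
  -- Bracketing S * (w·) * S in two ways gives ε_s(wh₁)S(h₂) = S(h₁)wε_t(h₂).
  have e3 := mul_assoc (toConv (antipode (k := k) (H := H))) (toConv (LinearMap.mulLeft k w))
    (toConv (antipode (k := k) (H := H)))
  rw [e1, e2] at e3
  have e4 := congrArg (fun f => f.ofConv h) e3
  refine (r.convMul_apply _ _).symm.trans (e4.trans ((r.convMul_apply _ _).trans ?_))
  -- Since w lies in H_s it commutes with ε_t(h₂), so it can be moved to the far right, leaving
  -- S(h₁)ε_t(h₂) = S(h).
  rw [← sum_antipode_mul_targetCounit r, Finset.sum_mul]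
  refine Finset.sum_congr rfl fun i _ => ?_
  rw [mul_assoc, ← hw, targetCounit_mul_sourceCounit_comm]
  rfl

/-- The antipode is anti-multiplicative. -/
theorem antipode_mul_rev (h g : H) :
    antipode (k := k) (h * g) = antipode (k := k) g * antipode (k := k) h := by
  -- The comparison takes place in the convolution algebra of maps H ⊗ H → H, where F and G, the two
  -- sides of the claim, act as inverses of P up to the local units Et and Es.
  let P : WithConv (H ⊗[k] H →ₗ[k] H) := toConv (LinearMap.mul' k H)
  let F : WithConv (H ⊗[k] H →ₗ[k] H) := toConv (antipode (k := k) ∘ₗ LinearMap.mul' k H)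
  let G : WithConv (H ⊗[k] H →ₗ[k] H) := toConv (LinearMap.mul' k H ∘ₗ
    TensorProduct.map (antipode (k := k)) (antipode (k := k)) ∘ₗ
      (TensorProduct.comm k H H).toLinearMap)
  let Et : WithConv (H ⊗[k] H →ₗ[k] H) := toConv (targetCounit k H ∘ₗ LinearMap.mul' k H)
  let Es : WithConv (H ⊗[k] H →ₗ[k] H) := toConv (sourceCounit k H ∘ₗ LinearMap.mul' k H)
  have ext2 : ∀ X Y : WithConv (H ⊗[k] H →ₗ[k] H),
      (∀ a b, X (a ⊗ₜ[k] b) = Y (a ⊗ₜ[k] b)) → X = Y := fun X Y h => by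
    apply WithConv.ofConv_injective
    exact TensorProduct.ext' h
  have conv : ∀ (X Y : WithConv (H ⊗[k] H →ₗ[k] H)) (a b : H), (X * Y) (a ⊗ₜ[k] b) =
      ∑ i ∈ (ℛ k a).index, ∑ j ∈ (ℛ k b).index,
        X ((ℛ k a).left i ⊗ₜ[k] (ℛ k b).left j) *
          Y ((ℛ k a).right i ⊗ₜ[k] (ℛ k b).right j) := fun X Y a b => by
    rw [LinearMap.convMul_apply, TensorProduct.comul_tmul]
    conv_lhs => rw [← (ℛ k a).eq, ← (ℛ k b).eq]
    simp only [TensorProduct.sum_tmul, TensorProduct.tmul_sum, map_sum,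
      TensorProduct.AlgebraTensorModule.tensorTensorTensorComm_tmul, TensorProduct.map_tmul,
      LinearMap.mul'_apply]
    rw [Finset.sum_comm]
  have hPF : P * F = Et := ext2 _ _ fun a b => by
    have := sum_mul_antipode (reprMul (ℛ k a) (ℛ k b))
    rw [reprMul, Finset.sum_product] at this
    exact (conv _ _ a b).trans this
  have hFP : F * P = Es := ext2 _ _ fun a b => by
    have := sum_antipode_mul (reprMul (ℛ k a) (ℛ k b))
    rw [reprMul, Finset.sum_product] at this
    exact (conv _ _ a b).trans this
  have hFE : F * Et = F := ext2 _ _ fun a b => by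
    have := sum_antipode_mul_targetCounit (reprMul (ℛ k a) (ℛ k b))
    rw [reprMul, Finset.sum_product] at this
    exact (conv _ _ a b).trans this
  -- a₁b₁S(b₂)S(a₂) = a₁ε_t(b)S(a₂) = ε_t(aε_t(b)) = ε_t(ab).
  have hPG : P * G = Et := ext2 _ _ fun a b => by
    refine (conv _ _ a b).trans ?_
    change _ = targetCounit k H (a * b)
    rw [← targetCounit_mul_targetCounit, ← sum_mul_target_mul_antipode (ℛ k a)
      (targetCounit_targetCounit b)]
    refine Finset.sum_congr rfl fun i _ => ?_
    rw [← sum_mul_antipode (ℛ k b), Finset.mul_sum, Finset.sum_mul]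
    refine Finset.sum_congr rfl fun j _ => ?_
    simp [P, G, mul_assoc]
  have hGP : G * P = Es := ext2 _ _ fun a b => by
    refine (conv _ _ a b).trans ?_
    change _ = sourceCounit k H (a * b)
    rw [← sourceCounit_sourceCounit_mul, ← sum_antipode_mul_source_mul (ℛ k b)
      (sourceCounit_sourceCounit a), Finset.sum_comm]
    refine Finset.sum_congr rfl fun i _ => ?_
    rw [← sum_antipode_mul (ℛ k a), Finset.mul_sum, Finset.sum_mul]
    refine Finset.sum_congr rfl fun j _ => ?_
    simp [P, G, mul_assoc]
  -- ε_s(a₁b₁)S(b₂)S(a₂) = ε_s(ε_s(a₁)b₁)S(b₂)S(a₂) = S(b)ε_s(a₁)S(a₂) = S(b)S(a).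
  have hEG : Es * G = G := by
    refine ext2 _ _ fun a b => (conv _ _ a b).trans ?_
    change _ = antipode (k := k) b * antipode (k := k) a
    rw [← sum_sourceCounit_mul_antipode (ℛ k a), Finset.mul_sum]
    refine Finset.sum_congr rfl fun i _ => ?_
    rw [← mul_assoc, ← sum_sourceCounit_source_mul_mul_antipode (ℛ k b)
      (sourceCounit_sourceCounit _), Finset.sum_mul]
    refine Finset.sum_congr rfl fun j _ => ?_
    simp [Es, G, mul_assoc, sourceCounit_sourceCounit_mul]
  -- F = F * Et = F * (P * G) = (F * P) * G = Es * G = G.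
  have : F = G := by
    rw [← hFE, ← hPG, ← mul_assoc, hFP, hEG]
  simpa [F, G] using congrArg (fun X => X.ofConv (h ⊗ₜ[k] g)) this

end Antipode

/-! ### Injectivity of the antipode. -/

section AntipodeBijective

variable {k : Type u} {H : Type v} [Field k] [Ring H] [Algebra k H] [Coalgebra k H]
  [WeakHopfAlgebra k H]

open WeakHopfAlgebra WithConv

/-- `S(z) = ε_s(z)` for `z ∈ H_t`. -/
theorem antipode_target {z : H} (hz : targetCounit k H z = z) :
    antipode (k := k) z = sourceCounit k H z := by
  have e : comul (R := k) z = ∑ i ∈ (ℛ k (1 : H)).index,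
      ((ℛ k (1 : H)).left i * z) ⊗ₜ[k] (ℛ k (1 : H)).right i := by
    rw [comul_target' hz]
    conv_lhs => rw [← (ℛ k (1 : H)).eq]
    simp [Finset.sum_mul]
  -- With Δ(z) = 1₁z ⊗ 1₂ one gets ε_s(z) = S(1₁z)1₂ = S(z)S(1₁)1₂ = S(z)ε_s(1) = S(z).
  have := sum_antipode_mul (⟨_, _, _, e.symm⟩ : Coalgebra.Repr k z _)
  rw [← this]
  simp only [antipode_mul_rev, mul_assoc]
  rw [← Finset.mul_sum, sum_antipode_mul, sourceCounit_one, mul_one]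

/-- `S(w) = ε_t(w)` for `w ∈ H_s`. -/
theorem antipode_source {w : H} (hw : sourceCounit k H w = w) :
    antipode (k := k) w = targetCounit k H w := by
  have e : comul (R := k) w = ∑ i ∈ (ℛ k (1 : H)).index,
      (ℛ k (1 : H)).left i ⊗ₜ[k] (w * (ℛ k (1 : H)).right i) := by
    rw [comul_source' hw]
    conv_lhs => rw [← (ℛ k (1 : H)).eq]
    simp [Finset.mul_sum]
  have := sum_mul_antipode (⟨_, _, _, e.symm⟩ : Coalgebra.Repr k w _)
  rw [← this]
  simp only [antipode_mul_rev, ← mul_assoc]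
  rw [← Finset.sum_mul, sum_mul_antipode, targetCounit_one, one_mul]

theorem antipode_one : antipode (k := k) (1 : H) = 1 := by
  rw [antipode_target targetCounit_one, sourceCounit_one]

/-- `S(1₁)ε(1₂h) = ε_t(h)`. -/
theorem sum_counit_smul_antipode_left {ι : Type*} (r : Coalgebra.Repr k (1 : H) ι) (h : H) :
    ∑ i ∈ r.index, counit (R := k) (r.right i * h) • antipode (k := k) (r.left i) =
      targetCounit k H h := by
  have hs := congrArg ((TensorProduct.rid k H).toLinearMap ∘ₗ
    TensorProduct.map (antipode (k := k)) (counit (R := k) ∘ₗ LinearMap.mulRight k h))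
    (sum_sourceCounit_tmul r)
  simp only [map_sum, LinearMap.comp_apply, TensorProduct.map_tmul, LinearEquiv.coe_coe,
    TensorProduct.rid_tmul, LinearMap.mulRight_apply,
    antipode_source (sourceCounit_sourceCounit _)] at hs
  have hs' := congrArg ((TensorProduct.rid k H).toLinearMap ∘ₗ
    TensorProduct.map (targetCounit k H) (counit (R := k) ∘ₗ LinearMap.mulRight k h))
    (sum_sourceCounit_tmul r)
  simp only [map_sum, LinearMap.comp_apply, TensorProduct.map_tmul, LinearEquiv.coe_coe,
    TensorProduct.rid_tmul, LinearMap.mulRight_apply] at hs'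
  -- Since 1₁ may be replaced by ε_s(1₁), where S equals ε_t, the sum becomes ε_t(1₁)ε(1₂h) =
  -- 1₂'ε(1₁'1₁)ε(1₂h). Weak multiplicativity collapses this to 1₂'ε(1₁'h).
  rw [← hs, hs', targetCounit_apply r]
  simp_rw [targetCounit_apply r, Finset.smul_sum]
  rw [Finset.sum_comm]
  refine Finset.sum_congr rfl fun i _ => ?_
  rw [counit_mul_eq_sum r _ h, Finset.sum_smul]
  refine Finset.sum_congr rfl fun j _ => ?_
  rw [smul_smul, mul_comm]

/-- `S(1₂)ε(h1₁) = ε_s(h)`. -/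
theorem sum_counit_smul_antipode_right {ι : Type*} (r : Coalgebra.Repr k (1 : H) ι) (h : H) :
    ∑ i ∈ r.index, counit (R := k) (h * r.left i) • antipode (k := k) (r.right i) =
      sourceCounit k H h := by
  have hs := congrArg ((TensorProduct.lid k H).toLinearMap ∘ₗ
    TensorProduct.map (counit (R := k) ∘ₗ LinearMap.mulLeft k h) (antipode (k := k)))
    (sum_tmul_targetCounit r)
  simp only [map_sum, LinearMap.comp_apply, TensorProduct.map_tmul, LinearEquiv.coe_coe,
    TensorProduct.lid_tmul, LinearMap.mulLeft_apply,
    antipode_target (targetCounit_targetCounit _)] at hs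
  have hs' := congrArg ((TensorProduct.lid k H).toLinearMap ∘ₗ
    TensorProduct.map (counit (R := k) ∘ₗ LinearMap.mulLeft k h) (sourceCounit k H))
    (sum_tmul_targetCounit r)
  simp only [map_sum, LinearMap.comp_apply, TensorProduct.map_tmul, LinearEquiv.coe_coe,
    TensorProduct.lid_tmul, LinearMap.mulLeft_apply] at hs'
  rw [← hs, hs', sourceCounit_apply r]
  simp_rw [sourceCounit_apply r, Finset.smul_sum]
  rw [Finset.sum_comm]
  refine Finset.sum_congr rfl fun i _ => ?_
  rw [counit_mul_eq_sum r h _, Finset.sum_smul]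
  refine Finset.sum_congr rfl fun j _ => ?_
  rw [smul_smul]

/-- If `f` commutes with `ρ(S(h))` for all `h`, then it commutes with `ρ(h)` for all `h`. -/
theorem commute_of_commute_antipode {E : Type*} [Ring E] [Algebra k E] (ρ : H →ₐ[k] E) {f : E}
    (hf : ∀ h, Commute f (ρ (antipode (k := k) h))) (h : H) : Commute f (ρ h) := by
  -- Every value of ε_t and of ε_s is a combination of values of S, so the hypothesis already covers
  -- them.
  have ht : ∀ h, Commute f (ρ (targetCounit k H h)) := fun h => by
    rw [← sum_counit_smul_antipode_left (ℛ k 1), map_sum]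
    exact Commute.sum_right _ _ _ fun i _ => by rw [map_smul]; exact (hf _).smul_right _
  have hs : ∀ h, Commute f (ρ (sourceCounit k H h)) := fun h => by
    rw [← sum_counit_smul_antipode_right (ℛ k 1), map_sum]
    exact Commute.sum_right _ _ _ fun i _ => by rw [map_smul]; exact (hf _).smul_right _
  let R : WithConv (H →ₗ[k] E) := toConv ρ.toLinearMap
  let F : WithConv (H →ₗ[k] E) :=
    toConv (LinearMap.mulLeft k f ∘ₗ ρ.toLinearMap ∘ₗ antipode (k := k))
  have e1 : R * F = toConv (LinearMap.mulLeft k f ∘ₗ ρ.toLinearMap ∘ₗ targetCounit k H) := by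
    ext h
    refine ((ℛ k h).convMul_apply _ _).trans ?_
    change ∑ i ∈ _, ρ _ * (f * ρ _) = f * ρ _
    simp only [(hf _).eq, (ht _).eq, ← mul_assoc, ← map_mul, ← Finset.sum_mul, ← map_sum,
      sum_mul_antipode]
  have e2 : F * R = toConv (LinearMap.mulRight k f ∘ₗ ρ.toLinearMap ∘ₗ sourceCounit k H) := by
    ext h
    refine ((ℛ k h).convMul_apply _ _).trans ?_
    change ∑ i ∈ _, f * ρ _ * ρ _ = ρ _ * f
    simp only [← (hs _).eq, mul_assoc, ← map_mul, ← Finset.mul_sum, ← map_sum,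
      sum_antipode_mul]
  -- The left bracketing evaluates to fρ(ε_t(h₁)h₂) = fρ(h), the right one to ρ(h₁ε_s(h₂))f = ρ(h)f.
  have e3 : R * F * R = R * (F * R) := mul_assoc _ _ _
  rw [e1, e2] at e3
  have e4 := ((ℛ k h).convMul_apply _ _).symm.trans ((congrArg (fun X => X.ofConv h) e3).trans
    ((ℛ k h).convMul_apply _ _))
  change ∑ i ∈ _, f * ρ _ * ρ _ = ∑ i ∈ _, ρ _ * (ρ _ * f) at e4
  simp only [mul_assoc, ← map_mul, ← Finset.mul_sum, ← map_sum, sum_targetCounit_mul] at e4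
  simp only [← mul_assoc, ← map_mul, ← Finset.sum_mul, ← map_sum, sum_mul_sourceCounit] at e4
  exact e4

/-- If `f` commutes with `ρ(Sⁿ(h))` for all `h`, then it commutes with `ρ(h)` for all `h`. -/
theorem commute_of_commute_antipode_pow (n : ℕ) {E : Type*} [Ring E] [Algebra k E]
    (ρ : H →ₐ[k] E) {f : E}
    (hf : ∀ h, Commute f (ρ (((antipode (k := k) : Module.End k H) ^ n) h))) (h : H) :
    Commute f (ρ h) := by
  induction n generalizing E h with
  | zero => exact hf h
  | succ n ih =>
    -- ρ ∘ S reverses products, so it is a homomorphism into the opposite algebra. The induction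
    -- hypothesis applied to it removes n antipodes and the one-step lemma removes the last; this is
    -- why E varies in the induction.
    let ρ' : H →ₐ[k] Eᵐᵒᵖ := AlgHom.ofLinearMap
      ((MulOpposite.opLinearEquiv k).toLinearMap ∘ₗ ρ.toLinearMap ∘ₗ antipode (k := k))
      (by simp [antipode_one]) (by simp [antipode_mul_rev])
    refine commute_of_commute_antipode ρ (fun g => ?_) h
    refine MulOpposite.commute_op.1 (ih ρ' (f := MulOpposite.op f) (fun g => ?_) g)
    refine MulOpposite.commute_op.2 ?_
    have := hf g
    rw [pow_succ'] at this
    exact this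

/-- The kernel of Sⁿ is a two-sided ideal. Both sides are proved at once because each application of
S interchanges them. -/
theorem antipode_pow_eq_zero_mul (n : ℕ) {a : H}
    (ha : ((antipode (k := k) : Module.End k H) ^ n) a = 0) (b : H) :
    ((antipode (k := k) : Module.End k H) ^ n) (a * b) = 0 ∧
      ((antipode (k := k) : Module.End k H) ^ n) (b * a) = 0 := by
  induction n generalizing a b with
  | zero => simp_all
  | succ n ih =>
    rw [pow_succ] at ha ⊢
    simp only [Module.End.mul_apply, antipode_mul_rev] at ha ⊢
    exact (ih ha _).symm

theorem mul_mem_range_antipode_pow (n : ℕ) {a b : H}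
    (ha : a ∈ LinearMap.range ((antipode (k := k) : Module.End k H) ^ n))
    (hb : b ∈ LinearMap.range ((antipode (k := k) : Module.End k H) ^ n)) :
    a * b ∈ LinearMap.range ((antipode (k := k) : Module.End k H) ^ n) := by
  induction n generalizing a b with
  | zero => simp
  | succ n ih =>
    obtain ⟨x, rfl⟩ := ha
    obtain ⟨y, rfl⟩ := hb
    obtain ⟨z, hz⟩ := ih ⟨y, rfl⟩ ⟨x, rfl⟩
    refine ⟨z, ?_⟩
    rw [pow_succ', Module.End.mul_apply, hz, Module.End.mul_apply, Module.End.mul_apply,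
      antipode_mul_rev]

/-- Fitting's decomposition splits H into the ideal ker Sⁿ and the subalgebra im Sⁿ. The projection
to im Sⁿ turns out to be left H-linear, and it fixes 1. -/
theorem antipode_injective [FiniteDimensional k H] :
    Function.Injective (antipode (k := k) (H := H)) := by
  set T : Module.End k H := antipode (k := k) with hT
  -- The bound n ≥ 1 serves at the end, to place ker S inside ker Sⁿ.
  obtain ⟨n, hn1, hn⟩ := ((Filter.eventually_ge_atTop 1).and
    (LinearMap.eventually_isCompl_ker_pow_range_pow T)).exists
  let π : Module.End k H := Submodule.projection _ _ hn.symm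
  -- Left multiplication by an element of im Sⁿ preserves both summands, so it commutes with π.
  have hπ : ∀ b x, π ((T ^ n) b * x) = (T ^ n) b * π x := fun b x => by
    have hx := Submodule.projection_add_projection_eq_self hn.symm x
    have h1 : (T ^ n) b * π x ∈ LinearMap.range (T ^ n) :=
      mul_mem_range_antipode_pow n ⟨b, rfl⟩ (Submodule.projection_apply_mem hn.symm x)
    have h2 : (T ^ n) b * Submodule.projection _ _ hn x ∈ LinearMap.ker (T ^ n) :=
      (antipode_pow_eq_zero_mul n (Submodule.projection_apply_mem hn x) _).2
    conv_lhs => rw [← hx, mul_add, map_add]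
    exact (congrArg₂ (· + ·) (Submodule.projection_apply_of_mem_left hn.symm h1)
      (Submodule.projection_apply_of_mem_right hn.symm h2)).trans (add_zero _)
  have hc := commute_of_commute_antipode_pow (k := k) n (Algebra.lmul k H) (f := π)
    (fun h => LinearMap.ext fun x => hπ h x)
  have hTone : (T ^ n) 1 = 1 := by
    rw [Module.End.pow_apply]
    exact Function.iterate_fixed antipode_one n
  have hone : π 1 = 1 := Submodule.projection_apply_of_mem_left hn.symm ⟨1, hTone⟩
  -- π commutes with all left multiplications, so π(x) = xπ(1) = x.
  have hid : ∀ x, π x = x := fun x => by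
    have := LinearMap.congr_fun (hc x).eq 1
    simpa [hone] using this
  have hker : ∀ x, T x = 0 → x = 0 := fun x hx => by
    have h0 : x ∈ LinearMap.ker (T ^ n) := by
      obtain ⟨m, rfl⟩ := Nat.exists_eq_add_of_le' hn1
      rw [LinearMap.mem_ker, pow_succ, Module.End.mul_apply, hx, map_zero]
    rw [← hid x]
    exact Submodule.projection_apply_of_mem_right hn.symm h0
  exact (injective_iff_map_eq_zero _).2 hker

end AntipodeBijective

/-! ### Anticomultiplicativity of the antipode, by duality. -/

section AntiComul

variable {k : Type u} {H : Type v} [Field k] [Ring H] [Algebra k H] [Coalgebra k H]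
  [WeakHopfAlgebra k H] [FiniteDimensional k H]

open WeakHopfAlgebra

/-- The antipode is anti-comultiplicative. -/
theorem comul_antipode (h : H) :
    comul (R := k) (antipode (k := k) h) = TensorProduct.map (antipode (k := k))
      (antipode (k := k)) (TensorProduct.comm k H H (comul (R := k) h)) := by
  have key : ∀ X : DualAlg k H ⊗[k] DualAlg k H, ev2 X (comul (R := k) (antipode (k := k) h)) =
      ev2 X (TensorProduct.map (antipode (k := k))
      (antipode (k := k)) (TensorProduct.comm k H H (comul (R := k) h))) := by
    intro X
    induction X with
    | zero => simp
    | add X Y hX hY => simp only [map_add, LinearMap.add_apply, hX, hY]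
    | tmul φ ψ =>
      -- Antimultiplicativity in the weak Hopf algebra H^*, whose antipode is the transpose of S,
      -- evaluated at h.
      have e := congrArg (fun χ : DualAlg k H => χ h) (antipode_mul_rev (k := k) φ ψ)
      change (φ * ψ) (antipode (k := k) h) = (dualAntipode ψ * dualAntipode φ) h at e
      rw [dual_mul_apply (ℛ k _), dual_mul_apply (ℛ k h)] at e
      conv_rhs => rw [← (ℛ k h).eq]
      conv_lhs => rw [← (ℛ k _).eq]
      simp only [map_sum, TensorProduct.comm_tmul, TensorProduct.map_tmul, ev2_tmul, e,
        dualAntipode_apply, mul_comm]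
  -- Linear forms separate the points of H ⊗ H, and by finite dimension each of them comes from H^*
  -- ⊗ H^*.
  rw [← sub_eq_zero, ← Module.forall_dual_apply_eq_zero_iff k]
  intro f
  have := key (ev2.symm f)
  rw [ev2.apply_symm_apply] at this
  rw [map_sub, this, sub_self]

end AntiComul

/-! ### The inverse antipode and its Sweedler identities. -/

section AntipodeEquiv

variable (k : Type u) (H : Type v) [Field k] [Ring H] [Algebra k H] [Coalgebra k H]
  [WeakHopfAlgebra k H] [FiniteDimensional k H]

open WeakHopfAlgebra

/-- The antipode of a finite quantum groupoid as a linear equivalence. -/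
def antipodeEquiv : H ≃ₗ[k] H := LinearEquiv.ofInjectiveEndo antipode antipode_injective

variable {k H}

theorem antipodeEquiv_apply (h : H) : antipodeEquiv k H h = antipode (k := k) h := rfl

local notation "Si" => LinearEquiv.symm (antipodeEquiv k H)

theorem antipode_symm_apply (h : H) : antipode (k := k) (Si h) = h :=
  (antipodeEquiv k H).apply_symm_apply h

theorem antipodeEquiv_symm_antipode (h : H) : Si (antipode (k := k) h) = h :=
  (antipodeEquiv k H).symm_apply_apply h

theorem antipodeEquiv_symm_mul (h g : H) : Si (h * g) = Si g * Si h := by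
  rw [LinearEquiv.symm_apply_eq, antipodeEquiv_apply, antipode_mul_rev, antipode_symm_apply,
    antipode_symm_apply]

/-- `Δ(S⁻¹(h)) = S⁻¹(h₂) ⊗ S⁻¹(h₁)`. -/
def reprAntipodeSymm {ι : Type*} {h : H} (r : Coalgebra.Repr k h ι) :
    Coalgebra.Repr k (Si h) ι where
  index := r.index
  left i := Si (r.right i)
  right i := Si (r.left i)
  eq := by
    have := comul_antipode (k := k) (Si h)
    rw [antipode_symm_apply, ← r.eq] at this
    have := congrArg (TensorProduct.map (Si).toLinearMap (Si).toLinearMap) this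
    rw [← LinearMap.comp_apply, ← TensorProduct.map_comp] at this
    have e : (Si).toLinearMap ∘ₗ antipode (k := k) = LinearMap.id :=
      LinearMap.ext antipodeEquiv_symm_antipode
    rw [e, TensorProduct.map_id, LinearMap.id_apply] at this
    refine (TensorProduct.comm k H H).injective (Eq.trans ?_ this)
    simp

/-- `S⁻¹(h₂)h₁ = S⁻¹(ε_s(h))`. -/
theorem sum_antipodeEquiv_symm_mul {ι : Type*} {h : H} (r : Coalgebra.Repr k h ι) :
    ∑ i ∈ r.index, Si (r.right i) * r.left i = Si (sourceCounit k H h) := by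
  rw [← sum_antipode_mul r, map_sum]
  simp only [antipodeEquiv_symm_mul, antipodeEquiv_symm_antipode]

/-- `h₂S⁻¹(h₁) = S⁻¹(ε_t(h))`. -/
theorem sum_mul_antipodeEquiv_symm {ι : Type*} {h : H} (r : Coalgebra.Repr k h ι) :
    ∑ i ∈ r.index, r.right i * Si (r.left i) = Si (targetCounit k H h) := by
  rw [← sum_mul_antipode r, map_sum]
  simp only [antipodeEquiv_symm_mul, antipodeEquiv_symm_antipode]

/-- `S⁻¹(ε_s(h)) = 1₂ε(h1₁)`. -/
theorem antipodeEquiv_symm_sourceCounit {ι : Type*} (r : Coalgebra.Repr k (1 : H) ι) (h : H) :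
    Si (sourceCounit k H h) = ∑ i ∈ r.index, counit (R := k) (h * r.left i) • r.right i := by
  rw [← sum_counit_smul_antipode_right r, map_sum]
  simp only [map_smul, antipodeEquiv_symm_antipode]

/-- `S⁻¹(ε_t(h)) = 1₁ε(1₂h)`. -/
theorem antipodeEquiv_symm_targetCounit {ι : Type*} (r : Coalgebra.Repr k (1 : H) ι) (h : H) :
    Si (targetCounit k H h) = ∑ i ∈ r.index, counit (R := k) (r.right i * h) • r.left i := by
  rw [← sum_counit_smul_antipode_left r, map_sum]
  simp only [map_smul, antipodeEquiv_symm_antipode]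

/-- S⁻¹ carries H_s into H_t: its values there are combinations of right legs of Δ(1), which ε_t
fixes. -/
theorem targetCounit_antipodeEquiv_symm (h : H) :
    targetCounit k H (Si (sourceCounit k H h)) = Si (sourceCounit k H h) := by
  have := congrArg ((TensorProduct.lid k H).toLinearMap ∘ₗ
    (counit (R := k) (A := H) ∘ₗ LinearMap.mulLeft k h).rTensor H)
    (sum_tmul_targetCounit (ℛ k (1 : H)))
  rw [antipodeEquiv_symm_sourceCounit (ℛ k 1), map_sum]
  simpa using this

theorem sourceCounit_antipodeEquiv_symm (h : H) :
    sourceCounit k H (Si (targetCounit k H h)) = Si (targetCounit k H h) := by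
  have := congrArg ((TensorProduct.rid k H).toLinearMap ∘ₗ
    (counit (R := k) (A := H) ∘ₗ LinearMap.mulRight k h).lTensor H)
    (sum_sourceCounit_tmul (ℛ k (1 : H)))
  rw [antipodeEquiv_symm_targetCounit (ℛ k 1), map_sum]
  simpa using this

/-- `S⁻¹(ε_t(h₂))h₁ = h`. -/
theorem sum_antipodeEquiv_symm_targetCounit_mul {ι : Type*} {h : H} (r : Coalgebra.Repr k h ι) :
    ∑ i ∈ r.index, Si (targetCounit k H (r.right i)) * r.left i = h := by
  refine Eq.trans ?_ (antipodeEquiv_symm_antipode (k := k) h)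
  rw [← sum_antipode_mul_targetCounit r, map_sum]
  simp only [antipodeEquiv_symm_mul, antipodeEquiv_symm_antipode]

/-- `ε(zh₁)h₂ = zh` for `z ∈ H_t`. -/
theorem sum_counit_target_mul_smul {ι : Type*} {h : H} (r : Coalgebra.Repr k h ι) {z : H}
    (hz : targetCounit k H z = z) :
    ∑ i ∈ r.index, counit (R := k) (z * r.left i) • r.right i = z * h :=
  Coalgebra.sum_counit_smul (a := z * h) (⟨r.index, fun i => z * r.left i, r.right, by
    rw [comul_target_mul hz, ← r.eq, Finset.mul_sum]; simp⟩ : Coalgebra.Repr k (z * h) ι)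

/-- `S⁻¹(ε_t(h₁)) ⊗ h₂ = 1₁ ⊗ 1₂h`. -/
theorem sum_antipodeEquiv_symm_targetCounit_tmul {ι κ : Type*} {h : H} (r : Coalgebra.Repr k h ι)
    (s : Coalgebra.Repr k (1 : H) κ) :
    ∑ i ∈ r.index, Si (targetCounit k H (r.left i)) ⊗ₜ[k] r.right i =
      ∑ j ∈ s.index, s.left j ⊗ₜ[k] (s.right j * h) := by
  -- Writing ε_t(1₂) for 1₂ on both sides puts an element of H_t in front, and then ε(ε_t(1₂)h₁)h₂ =
  -- ε_t(1₂)h applies.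
  have h1 := congrArg ((LinearMap.mulRight k h).lTensor H) (sum_tmul_targetCounit s)
  have h2 := fun g : H => congrArg ((TensorProduct.rid k H).toLinearMap ∘ₗ
    (counit (R := k) (A := H) ∘ₗ LinearMap.mulRight k g).lTensor H) (sum_tmul_targetCounit s)
  simp only [map_sum, LinearMap.lTensor_tmul, LinearMap.mulRight_apply, LinearMap.comp_apply,
    LinearEquiv.coe_coe, TensorProduct.rid_tmul] at h1 h2
  rw [← h1]
  simp only [antipodeEquiv_symm_targetCounit s, ← h2]
  simp only [← sum_counit_target_mul_smul r (targetCounit_targetCounit _),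
    TensorProduct.tmul_sum, TensorProduct.sum_tmul, TensorProduct.tmul_smul,
    TensorProduct.smul_tmul']
  rw [Finset.sum_comm]

/-- `(φ ⇀ h₂)S⁻¹(h₁) = 1₁⟨φ, 1₂h⟩`. -/
theorem sum_hit_mul_antipodeEquiv_symm {ι κ : Type*} {h : H} (r : Coalgebra.Repr k h ι)
    (s : Coalgebra.Repr k (1 : H) κ) (φ : DualAlg k H) :
    ∑ i ∈ r.index, hit φ (r.right i) * Si (r.left i) =
      ∑ j ∈ s.index, φ (s.right j * h) • s.left j := by
  -- By coassociativity the left side is h₂S⁻¹(h₁)⟨φ, h₃⟩ = S⁻¹(ε_t(h₁))⟨φ, h₂⟩.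
  have hc := congrArg (LinearMap.mul' k H ∘ₗ (TensorProduct.comm k H H).toLinearMap ∘ₗ
      TensorProduct.map (Si).toLinearMap ((TensorProduct.rid k H).toLinearMap ∘ₗ
        (toLin φ).lTensor H))
    (Coalgebra.sum_tmul_tmul_eq r (fun i => ℛ k (r.left i)) (fun i => ℛ k (r.right i)))
  have h1 := congrArg ((TensorProduct.rid k H).toLinearMap ∘ₗ (toLin φ).lTensor H)
    (sum_antipodeEquiv_symm_targetCounit_tmul r s)
  simp only [map_sum, LinearMap.lTensor_tmul, TensorProduct.map_tmul, LinearMap.comp_apply,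
    LinearEquiv.coe_coe, TensorProduct.rid_tmul, TensorProduct.comm_tmul,
    LinearMap.mul'_apply] at hc h1
  rw [← h1]
  refine Eq.trans ?_ (hc.symm.trans ?_) <;> refine Finset.sum_congr rfl fun i _ => ?_
  · rw [hit_apply (ℛ k (r.right i)), Finset.sum_mul]
  · simp only [smul_mul_assoc, ← Finset.smul_sum, sum_mul_antipodeEquiv_symm]

end AntipodeEquiv

/-! ### Linearity of x # h in x. -/

section Linearity

variable {k : Type u} {A : Type w} {H : Type v} [Field k] [Ring H] [Algebra k H] [Coalgebra k H]
  [Ring A] [Algebra k A] [Module H A]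

namespace SmashProduct

theorem smul_mk (c : k) (x : A) (h : H) : mk k (c • x) h = c • mk k x h := by
  simp only [← proj_tmul, ← TensorProduct.smul_tmul', map_smul]

theorem sum_mk {ι : Type*} (s : Finset ι) (f : ι → A) (h : H) :
    mk k (∑ i ∈ s, f i) h = ∑ i ∈ s, mk k (f i) h := by
  simp only [← proj_tmul, TensorProduct.sum_tmul, map_sum]

end SmashProduct

end Linearity

/-! ### The duality isomorphism. -/

section Duality

variable {k : Type u} {A : Type w} {H : Type v} [Field k] [Ring H] [Algebra k H] [Coalgebra k H]
  [WeakHopfAlgebra k H] [FiniteDimensional k H]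
  [Ring A] [Algebra k A] [Module H A] [IsScalarTower k H A] [ModuleAlgebra k H A]

open WeakHopfAlgebra

local notation "Si" => LinearEquiv.symm (antipodeEquiv k H)

namespace SmashProduct

/-- Both sides equal y(g₁·w) # g₂⟨φ, g₃⟩ when v = y # g. -/
theorem dual_smul_mul_mk_one (φ : DualAlg k H) (v : SmashProduct k A H) (w : A) :
    φ • (v * mk k w 1) = φ • v * mk k w 1 := by
  induction v using induction_on with
  | zero => simp
  | add u v hu hv => simp only [add_mul, smul_add, hu, hv]
  | mk y g =>
    have hc := congrArg (proj k A H ∘ₗ TensorProduct.map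
        (LinearMap.mul k A y ∘ₗ (LinearMap.toSpanSingleton H A w).restrictScalars k)
        ((TensorProduct.rid k H).toLinearMap ∘ₗ (toLin φ).lTensor H))
      (Coalgebra.sum_tmul_tmul_eq (ℛ k g) (fun i => ℛ k ((ℛ k g).left i))
        (fun i => ℛ k ((ℛ k g).right i)))
    simp only [map_sum, LinearMap.comp_apply, TensorProduct.map_tmul, LinearEquiv.coe_coe,
      LinearMap.lTensor_tmul, TensorProduct.rid_tmul, LinearMap.restrictScalars_apply,
      LinearMap.mul_apply', LinearMap.toSpanSingleton_apply, proj_tmul, mk_smul] at hc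
    rw [mk_mul_mk _ _ _ (ℛ k g), Finset.smul_sum, dual_smul_mk, hit_apply (ℛ k g), mk_sum,
      Finset.sum_mul]
    refine Eq.trans ?_ (hc.symm.trans ?_) <;> refine Finset.sum_congr rfl fun i _ => ?_
    · rw [dual_smul_mk, mul_one, hit_apply (ℛ k _), mk_sum]
      simp only [mk_smul]
    · rw [mk_smul, smul_mul_assoc, mk_mul_mk _ _ _ (ℛ k _), Finset.smul_sum]
      simp only [mul_one]

/-- The endomorphism `w ↦ u(φ·w)` of the right `A`-module `A # H`. -/
def mulDualAct (u : SmashProduct k A H) (φ : DualAlg k H) :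
    Module.End Aᵐᵒᵖ (SmashProduct k A H) where
  toFun w := u * φ • w
  map_add' v w := by rw [smul_add, mul_add]
  map_smul' a w := by
    change u * φ • (w * mk k a.unop 1) = u * φ • w * mk k a.unop 1
    rw [dual_smul_mul_mk_one, mul_assoc]

theorem mulDualAct_apply (u w : SmashProduct k A H) (φ : DualAlg k H) :
    mulDualAct u φ w = u * φ • w := rfl

/-- The linear map `(A # H) # H^* → End(A # H)_A`, `u # φ ↦ (w ↦ u(φ·w))`. -/
def toEndLin : SmashProduct k (SmashProduct k A H) (DualAlg k H) →ₗ[k]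
    Module.End Aᵐᵒᵖ (SmashProduct k A H) :=
  liftLin (TensorProduct.lift (LinearMap.mk₂ k mulDualAct
      (fun u v φ => LinearMap.ext fun w => add_mul u v _)
      (fun c u φ => LinearMap.ext fun w => smul_mul_assoc c u _)
      (fun u φ ψ => LinearMap.ext fun w => by
        simp only [LinearMap.add_apply, mulDualAct_apply, add_smul, mul_add])
      (fun c u φ => LinearMap.ext fun w => by
        simp only [LinearMap.smul_apply, mulDualAct_apply, smul_assoc, mul_smul_comm])))
    (fun u z φ hz => LinearMap.ext fun w => by
      simp only [TensorProduct.lift.tmul, LinearMap.mk₂_apply, mulDualAct_apply]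
      rw [mul_smul, target_smul hz (φ • w), mul_assoc])

theorem toEndLin_mk (u : SmashProduct k A H) (φ : DualAlg k H) :
    toEndLin (mk k u φ) = mulDualAct u φ := rfl

/-- The homomorphism of algebras `(A # H) # H^* → End(A # H)_A`, `u # φ ↦ (w ↦ u(φ·w))`. -/
def toEnd : SmashProduct k (SmashProduct k A H) (DualAlg k H) →ₐ[k]
    Module.End Aᵐᵒᵖ (SmashProduct k A H) :=
  AlgHom.ofLinearMap toEndLin
    (LinearMap.ext fun w => by
      rw [one_def, toEndLin_mk, mulDualAct_apply, one_smul, one_mul, Module.End.one_apply])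
    (fun U V => by
      induction U using induction_on with
      | zero => simp
      | add U U' h h' => simp only [add_mul, map_add, h, h']
      | mk u φ =>
        induction V using induction_on with
        | zero => simp
        | add U U' h h' => simp only [mul_add, map_add, h, h']
        | mk v ψ =>
          rw [mk_mul_mk _ _ _ (ℛ k φ), map_sum]
          refine LinearMap.ext fun w => ?_
          rw [LinearMap.sum_apply, Module.End.mul_apply]
          simp only [toEndLin_mk, mulDualAct_apply]
          -- Multiplicativity is the module algebra axiom φ·(v(ψ·w)) = (φ₁·v)(φ₂ψ·w).
          rw [smul_mul_sum (ℛ k φ), Finset.mul_sum]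
          simp only [mul_smul, mul_assoc])

theorem toEnd_mk_apply (u w : SmashProduct k A H) (φ : DualAlg k H) :
    toEnd (mk k u φ) w = u * φ • w := rfl

/-- The embedding `h ↦ 1 # h` of `H` in `A # H`. -/
def mkOne : H →ₗ[k] SmashProduct k A H := proj k A H ∘ₗ TensorProduct.mk k A H 1

theorem mkOne_apply (h : H) : mkOne h = mk k (1 : A) h := rfl

/-- (h₁·1) # h₂g = 1 # ε_t(h₁)h₂g, and ε_t(h₁)h₂ = h. -/
theorem mk_one_mul_mk_one (h g : H) : mk k (1 : A) h * mk k 1 g = mk k 1 (h * g) := by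
  rw [mk_mul_mk _ _ _ (ℛ k h)]
  conv_rhs => rw [← sum_targetCounit_mul (ℛ k h)]
  simp only [mk_mul_smul_one _ _ _ (inferInstance : WeakHopfAlgebra k H), Finset.sum_mul, mk_sum,
    mul_assoc]

/-- `(1 # w)(y # g) = y # wg` for `w ∈ H_s`. -/
theorem mk_source_mul_mk {w : H} (hw : sourceCounit k H w = w) (y : A) (g : H) :
    mk k 1 w * mk k y g = mk k y (w * g) := by
  have e : comul (R := k) w = ∑ i ∈ (ℛ k (1 : H)).index,
      (ℛ k (1 : H)).left i ⊗ₜ[k] ((ℛ k (1 : H)).right i * w) := by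
    rw [comul_source hw]
    conv_lhs => rw [← (ℛ k (1 : H)).eq]
    simp [Finset.sum_mul]
  -- With Δ(w) = 1₁ ⊗ 1₂w, both sides expand to (1₁·y) # 1₂wg.
  rw [← one_mul (mk k y (w * g)), one_def, mk_mul_mk _ _ _ (ℛ k (1 : H)),
    mk_mul_mk _ _ _ (⟨_, _, _, e.symm⟩ : Coalgebra.Repr k w _)]
  simp only [mul_assoc]

/-- The map `h ↦ T(1 # h₂)(1 # S⁻¹(h₁))`. -/
def coefficient (T : SmashProduct k A H →ₗ[k] SmashProduct k A H) : H →ₗ[k] SmashProduct k A H :=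
  LinearMap.mul' k _ ∘ₗ TensorProduct.map (T ∘ₗ mkOne) (mkOne ∘ₗ (Si).toLinearMap) ∘ₗ
    (TensorProduct.comm k H H).toLinearMap ∘ₗ comul

theorem coefficient_apply {ι : Type*} (T : SmashProduct k A H →ₗ[k] SmashProduct k A H) {h : H}
    (r : Coalgebra.Repr k h ι) : coefficient T h =
      ∑ i ∈ r.index, T (mk k 1 (r.right i)) * mk k 1 (Si (r.left i)) := by
  simp only [coefficient, LinearMap.comp_apply, ← r.eq, map_sum]
  rfl

/-- `(1 # S⁻¹(g₂))(y # g₁) = (S⁻¹(g₂)·y)(S⁻¹(ε_s(g₁))·1) # 1`. -/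
theorem sum_mk_antipodeEquiv_symm_mul_mk {ι : Type*} {g : H} (r : Coalgebra.Repr k g ι) (y : A) :
    ∑ i ∈ r.index, mk k 1 (Si (r.right i)) * mk k y (r.left i) =
      mk k (∑ i ∈ r.index, (Si (r.right i) • y) * (Si (sourceCounit k H (r.left i)) • 1)) 1 := by
  have hc := congrArg (proj k A H ∘ₗ (TensorProduct.comm k H A).toLinearMap ∘ₗ TensorProduct.map
      (LinearMap.mul' k H ∘ₗ (TensorProduct.comm k H H).toLinearMap ∘ₗ
        (Si).toLinearMap.lTensor H)
      ((LinearMap.toSpanSingleton H A y).restrictScalars k ∘ₗ (Si).toLinearMap) ∘ₗ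
      (TensorProduct.assoc k H H H).symm.toLinearMap)
    (Coalgebra.sum_tmul_tmul_eq r (fun i => ℛ k (r.left i)) (fun i => ℛ k (r.right i)))
  simp only [map_sum, LinearMap.comp_apply, TensorProduct.map_tmul, LinearEquiv.coe_coe,
    LinearMap.lTensor_tmul, LinearMap.restrictScalars_apply, TensorProduct.assoc_symm_tmul,
    TensorProduct.comm_tmul, LinearMap.mul'_apply, LinearMap.toSpanSingleton_apply,
    proj_tmul] at hc
  rw [sum_mk]
  refine Eq.trans ?_ (hc.symm.trans ?_) <;> refine Finset.sum_congr rfl fun i _ => ?_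
  · rw [mk_mul_mk _ _ _ (reprAntipodeSymm (ℛ k (r.right i)))]
    simp only [one_mul]
    rfl
  -- After regrouping, the second factor S⁻¹(g₂)g₁ sums to S⁻¹(ε_s(g₁)), which lies in H_t and so
  -- crosses the relative tensor product into A.
  · rw [← mk_sum, sum_antipodeEquiv_symm_mul, mk_balanced _ (targetCounit_antipodeEquiv_symm _),
      mul_one]

/-- The factor to the right of T(1 # g₂) lies in A # 1 and does not depend on T. This allows the
comparison of a right A-linear T with the identity. -/
theorem sum_coefficient_mul_mk {ι : Type*} (T : SmashProduct k A H →ₗ[k] SmashProduct k A H)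
    {g : H} (r : Coalgebra.Repr k g ι) (y : A) :
    ∑ i ∈ r.index, coefficient T (r.right i) * mk k y (r.left i) =
      ∑ i ∈ r.index, T (mk k 1 (r.right i)) *
        mk k (∑ j ∈ (ℛ k (r.left i)).index, (Si ((ℛ k (r.left i)).right j) • y) *
          (Si (sourceCounit k H ((ℛ k (r.left i)).left j)) • 1)) 1 := by
  have hc := congrArg (LinearMap.mul' k (SmashProduct k A H) ∘ₗ
      TensorProduct.map (T ∘ₗ mkOne) (LinearMap.mul' k (SmashProduct k A H) ∘ₗ
        TensorProduct.map (mkOne ∘ₗ (Si).toLinearMap) (proj k A H ∘ₗ TensorProduct.mk k A H y) ∘ₗ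
        (TensorProduct.comm k H H).toLinearMap) ∘ₗ
      (TensorProduct.comm k (H ⊗[k] H) H).toLinearMap ∘ₗ
      (TensorProduct.assoc k H H H).symm.toLinearMap)
    (Coalgebra.sum_tmul_tmul_eq r (fun i => ℛ k (r.left i)) (fun i => ℛ k (r.right i)))
  simp only [map_sum, LinearMap.comp_apply, TensorProduct.map_tmul, LinearEquiv.coe_coe,
    TensorProduct.assoc_symm_tmul, TensorProduct.mk_apply,
    TensorProduct.comm_tmul, LinearMap.mul'_apply, mkOne_apply, proj_tmul] at hc
  refine Eq.trans ?_ (hc.symm.trans ?_) <;> refine Finset.sum_congr rfl fun i _ => ?_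
  · rw [coefficient_apply T (ℛ k (r.right i)), Finset.sum_mul]
    simp only [mul_assoc]
  · rw [← Finset.mul_sum, sum_mk_antipodeEquiv_symm_mul_mk]

theorem coefficient_id (h : H) :
    coefficient (A := A) LinearMap.id h = mk k 1 (Si (targetCounit k H h)) := by
  rw [coefficient_apply _ (ℛ k h), ← sum_mul_antipodeEquiv_symm (ℛ k h), mk_sum]
  simp only [LinearMap.id_apply, mk_one_mul_mk_one]

/-- `T(1 # g₃)(1 # S⁻¹(g₂))(y # g₁) = T(y # g)` for right `A`-linear `T`. -/
theorem sum_coefficient_end_mul_mk {ι : Type*} (T : Module.End Aᵐᵒᵖ (SmashProduct k A H)) {g : H}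
    (r : Coalgebra.Repr k g ι) (y : A) :
    ∑ i ∈ r.index, coefficient (T.restrictScalars k) (r.right i) * mk k y (r.left i) =
      T (mk k y g) := by
  have hT : ∀ u a, T u * mk k a 1 = T (u * mk k a 1) := fun u a =>
    (T.map_smul (MulOpposite.op a) u).symm
  -- For T = id the left side is y # S⁻¹(ε_t(g₂))g₁ = y # g, because S⁻¹(ε_t(g₂)) lies in H_s.
  -- Applying a right A-linear T to this expression of y # g gives the claim.
  have h1 := sum_coefficient_mul_mk LinearMap.id r y
  simp only [coefficient_id, mk_source_mul_mk (sourceCounit_antipodeEquiv_symm _),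
    LinearMap.id_apply] at h1
  rw [← mk_sum, sum_antipodeEquiv_symm_targetCounit_mul] at h1
  rw [sum_coefficient_mul_mk, h1, map_sum]
  simp only [LinearMap.restrictScalars_apply, hT]

/-- The map `T ↦ T(1 # (fᵢ)₂)(1 # S⁻¹((fᵢ)₁)) # ψᵢ` for a basis `f` of `H` with dual basis `ψ`. -/
def ofEnd {ι : Type*} [Fintype ι] (f : Module.Basis ι k H)
    (T : Module.End Aᵐᵒᵖ (SmashProduct k A H)) :
    SmashProduct k (SmashProduct k A H) (DualAlg k H) :=
  ∑ i, mk k (coefficient (T.restrictScalars k) (f i)) (toLin.symm (f.coord i))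

theorem sum_coord_smul {ι M : Type*} [Fintype ι] [AddCommGroup M] [Module k M]
    (f : Module.Basis ι k H) (Q : H →ₗ[k] M) (h : H) : ∑ i, f.coord i h • Q (f i) = Q h := by
  conv_rhs => rw [← f.sum_repr h, map_sum]
  simp

theorem toEnd_ofEnd {ι : Type*} [Fintype ι] (f : Module.Basis ι k H)
    (T : Module.End Aᵐᵒᵖ (SmashProduct k A H)) : toEnd (ofEnd f T) = T := by
  refine LinearMap.ext fun v => ?_
  rw [ofEnd, map_sum, LinearMap.sum_apply]
  simp only [toEnd_mk_apply]
  induction v using induction_on with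
  | zero => simp
  | add u v hu hv => simp only [smul_add, mul_add, Finset.sum_add_distrib, hu, hv, map_add]
  | mk y g =>
    rw [← sum_coefficient_end_mul_mk T (ℛ k g)]
    simp only [dual_smul_mk, hit_apply (ℛ k g), mk_sum, mk_smul, Finset.mul_sum]
    rw [Finset.sum_comm]
    refine Finset.sum_congr rfl fun j _ => ?_
    -- The dual bases recombine: Σᵢ c_T(fᵢ)⟨ψᵢ, g₂⟩ = c_T(g₂).
    rw [← sum_coord_smul f (coefficient _) ((ℛ k g).right j), Finset.sum_mul]
    refine Finset.sum_congr rfl fun i _ => ?_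
    rw [mul_smul_comm, smul_mul_assoc]
    rfl

theorem coefficient_toEnd (u : SmashProduct k A H) (φ : DualAlg k H) {κ : Type*}
    (s : Coalgebra.Repr k (1 : H) κ) (h : H) :
    coefficient ((toEnd (mk k u φ)).restrictScalars k) h =
      ∑ j ∈ s.index, φ (s.right j * h) • (u * mk k 1 (s.left j)) := by
  rw [coefficient_apply _ (ℛ k h)]
  have := congrArg (fun x => u * mk k (1 : A) x) (sum_hit_mul_antipodeEquiv_symm (ℛ k h) s φ)
  simp only [mk_sum, Finset.mul_sum, mk_smul, mul_smul_comm] at this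
  rw [← this]
  simp only [LinearMap.restrictScalars_apply, toEnd_mk_apply, dual_smul_mk, mul_assoc,
    mk_one_mul_mk_one]

/-- `⟨φ₁, a⟩φ₂ = ⟨φ, a·⟩`. -/
theorem sum_apply_smul_dual {ι : Type*} {φ : DualAlg k H} (r : Coalgebra.Repr k φ ι) (a : H) :
    ∑ i ∈ r.index, (r.left i) a • r.right i =
      toLin.symm (toLin φ ∘ₗ LinearMap.mulLeft k a) := by
  ext h
  have := ev2_comul φ a h
  rw [← r.eq] at this
  simp only [map_sum, LinearMap.sum_apply, ev2_tmul] at this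
  simpa using this

theorem sum_smul_coord {ι : Type*} [Fintype ι] (f : Module.Basis ι k H) (φ : H →ₗ[k] k) :
    ∑ i, φ (f i) • toLin.symm (f.coord i) = toLin.symm φ := by
  ext h
  simp

/-- The first expression is Σ u(1 # 1₁) # ⟨φ, 1₂·⟩. As ⟨φ, 1₂·⟩ = ⟨φ₁, 1₂⟩φ₂ and φ₁·1 = 1 # 1₁⟨φ₁,
1₂⟩, it equals u(φ₁·1) # φ₂, and the balancing over the target algebra of H^* turns this into u #
ε_t(φ₁)φ₂. -/
theorem ofEnd_toEnd_mk {ι : Type*} [Fintype ι] (f : Module.Basis ι k H)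
    (u : SmashProduct k A H) (φ : DualAlg k H) : ofEnd f (toEnd (mk k u φ)) = mk k u φ := by
  calc ofEnd f (toEnd (mk k u φ))
      = ∑ j ∈ (ℛ k (1 : H)).index, mk k (u * mk k 1 ((ℛ k (1 : H)).left j))
          (toLin.symm (toLin φ ∘ₗ LinearMap.mulLeft k ((ℛ k (1 : H)).right j))) := by
        rw [ofEnd]
        simp only [coefficient_toEnd u φ (ℛ k (1 : H)), sum_mk, smul_mk]
        rw [Finset.sum_comm]
        refine Finset.sum_congr rfl fun j _ => ?_
        rw [← sum_smul_coord f (toLin φ ∘ₗ _), mk_sum]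
        simp only [mk_smul, LinearMap.comp_apply, LinearMap.mulLeft_apply]
    _ = ∑ l ∈ (ℛ k φ).index, mk k (u * (ℛ k φ).left l • (1 : SmashProduct k A H))
          ((ℛ k φ).right l) := by
        simp only [← sum_apply_smul_dual (ℛ k φ), mk_sum, mk_smul]
        rw [Finset.sum_comm]
        refine Finset.sum_congr rfl fun l _ => ?_
        rw [one_def, dual_smul_mk, hit_apply (ℛ k (1 : H)), mk_sum, Finset.mul_sum]
        simp only [mk_smul, mul_smul_comm, sum_mk, smul_mk]
    _ = mk k u φ := by
        simp only [mk_mul_smul_one _ _ _ (inferInstance : WeakHopfAlgebra k (DualAlg k H))]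
        rw [← mk_sum, sum_targetCounit_mul]

theorem coefficient_add (T T' : SmashProduct k A H →ₗ[k] SmashProduct k A H) :
    coefficient (T + T') = coefficient T + coefficient T' := by
  ext h
  simp only [LinearMap.add_apply, coefficient_apply _ (ℛ k h), add_mul, Finset.sum_add_distrib]

theorem ofEnd_add {ι : Type*} [Fintype ι] (f : Module.Basis ι k H)
    (T T' : Module.End Aᵐᵒᵖ (SmashProduct k A H)) : ofEnd f (T + T') = ofEnd f T + ofEnd f T' := by
  simp only [ofEnd, LinearMap.restrictScalars_add, coefficient_add, LinearMap.add_apply,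
    ← proj_tmul, TensorProduct.add_tmul, map_add, Finset.sum_add_distrib]

theorem ofEnd_toEnd {ι : Type*} [Fintype ι] (f : Module.Basis ι k H)
    (U : SmashProduct k (SmashProduct k A H) (DualAlg k H)) : ofEnd f (toEnd U) = U := by
  induction U using induction_on with
  | zero =>
    rw [map_zero]
    -- Additivity at 0 + 0 forces the value at 0 to vanish.
    simpa using ofEnd_add f (0 : Module.End Aᵐᵒᵖ (SmashProduct k A H)) 0
  | add U V hU hV => rw [map_add, ofEnd_add, hU, hV]
  | mk u φ => exact ofEnd_toEnd_mk f u φ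

end SmashProduct
end Duality

end

end QuantumGroupoid

open QuantumGroupoid SmashProduct WeakHopfAlgebra in
open scoped Coalgebra in
theorem theorem3p3 {k H A : Type*} [Field k]
    [Ring H] [Algebra k H] [Coalgebra k H] [WeakHopfAlgebra k H] [FiniteDimensional k H]
    [Ring A] [Algebra k A] [Module H A] [IsScalarTower k H A] [ModuleAlgebra k H A] :
    ∃ S : H ≃ₗ[k] H, (∀ h : H, S h = antipode (k := k) h) ∧
    ∃ α : SmashProduct k (SmashProduct k A H) (DualAlg k H) ≃ₐ[k]
        Module.End Aᵐᵒᵖ (SmashProduct k A H),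
      (∀ (x y : A) (h g : H) (φ : DualAlg k H),
        α (mk k (mk k x h) φ) (mk k y g) = mk k x h * mk k y (hit φ g)) ∧
      (∀ {ι : Type*} [Fintype ι] (f : Module.Basis ι k H)
        (T : Module.End Aᵐᵒᵖ (SmashProduct k A H)),
        α.symm T = ∑ i, ∑ j ∈ (ℛ k (f i)).index,
          mk k (T (mk k 1 ((ℛ k (f i)).right j)) * mk k 1 (S.symm ((ℛ k (f i)).left j)))
            (toLin.symm (f.coord i))) := by
  -- One basis suffices for bijectivity. The formula for the inverse then holds for every basis f,
  -- since `toEnd_ofEnd` exhibits a preimage of T built from f.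
  refine ⟨antipodeEquiv k H, fun h => rfl, AlgEquiv.ofBijective toEnd
    ⟨Function.LeftInverse.injective (ofEnd_toEnd (Module.finBasis k H)),
      Function.RightInverse.surjective (toEnd_ofEnd (Module.finBasis k H))⟩,
    fun x y h g φ => rfl, fun f T => ?_⟩
  rw [AlgEquiv.symm_apply_eq]
  refine (toEnd_ofEnd f T).symm.trans (congrArg toEnd ?_)
  refine Finset.sum_congr rfl fun i _ => ?_
  rw [coefficient_apply _ (ℛ k (f i))]
  simp only [sum_mk, LinearMap.restrictScalars_apply]
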